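/- **Setting.** Let $K$ be a pathwise connected poset, $a\in K$, and $\Pi=\pi_1^a(K)$ the group of homotopy classes of loops over $a$, paths being finite sequences $b_n*\dots*b_1$ of 1-simplices of $K$. Let $(\mathcal A,\jmath)_K$ be a net of C*-algebras: unital C*-algebras $\mathcal A_o$ ($o\in K$) and unital injective *-morphisms $\jmath_{o'o}:\mathcal A_o\to\mathcal A_{o'}$ ($o\le o'$) with $\jmath_{o''o}=\jmath_{o''o'}\jmath_{o'o}$. Let $\beta=\{\beta_o\}$ be an automorphism of the net with $\beta^2=\mathrm{id}$; in the odd case we require $\beta=\mathrm{id}$. Let $\epsilon:(\mathcal A,\jmath)_K\to(\bar{\mathcal A},\bar\jmath)_K$ be the enveloping net bundle, i.e. the universal morphism into a net whose inclusion maps are *-isomorphisms; let $A=\bar{\mathcal A}_a$, with the action of $\Pi$ by parallel transport $[p]\mapsto\bar\jmath_p$ and the grading $\beta_*$ induced by $\beta$. $(A,\Pi)$ is the holonomy dynamical system. Below, $K(H)$ denotes the compact operators, $\mathrm{ad}\,U(T)=UTU^*$, and $[\,\cdot,\cdot\,]$ is the graded commutator: for $F$ paired with the image of $t$ under a representation $\rho$,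 $[F,\rho(t)]=F\rho(t)-\rho(\beta t)F$ (with $\beta_*$ in place of $\beta$ when $t\in A$); it is the ordinary commutator if $\beta=\mathrm{id}$. A *graded representation* consists of Hilbert spaces $\mathcal H_o$, unitaries $U_{o'o}:\mathcal H_o\to\mathcal H_{o'}$ ($o\le o'$) with $U_{o''o}=U_{o''o'}U_{o'o}$, unitaries $\Gamma_o$ on $\mathcal H_o$ with $\Gamma_o^2=1$ and $\Gamma_{o'}U_{o'o}=U_{o'o}\Gamma_o$, and *-morphisms $\pi_o:\mathcal A_o\to B(\mathcal H_o)$ with $\mathrm{ad}\,U_{o'o}\circ\pi_o=\pi_{o'}\circ\jmath_{o'o}$ and $\pi_o\circ\beta_o=\mathrm{ad}\,\Gamma_o\circ\pi_o$; in the odd case $\Gamma=1$. Let $U_p$ be the parallel transport along a path $p$. * An even/odd *Fredholm module* is a graded representation with operators $F_o=F_o^*\in B(\mathcal H_o)$ such that $U_{o'o}F_o=F_{o'}U_{o'o}$ for $o\le o'$, $F_o^2-1\in K(\mathcal H_o)$, $[F_o,\pi_o(t)]\in K(\mathcal H_o)$ for $t\in\mathcal A_o$, and, in the even case, $\mathrm{ad}\,\Gamma_o(F_o)=-F_o$.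 * An even/odd *Fredholm module localized in $a$* is a graded representation with one operator $F_a=F_a^*\in B(\mathcal H_a)$ such that $F_a^2-1$, $[F_a,\mathrm{ad}\,U_p\circ\pi_o(t)]$ and $\mathrm{ad}\,U_q(F_a)-F_a$ are compact for all $o$, $t\in\mathcal A_o$, $p:o\to a$, $q:a\to a$, and, in the even case, $\mathrm{ad}\,\Gamma_a(F_a)=-F_a$. An even/odd *cycle* over $A$ is a Hilbert space $H$ with a unitary representation $V$ of $\Pi$, a grading unitary $\Gamma$ with $\Gamma^2=1$ commuting with $V$ ($\Gamma=1$ in the odd case), a graded $\Pi$-covariant representation $\eta:A\to B(H)$, and $\phi\in B(H)$ (with $\mathrm{ad}\,\Gamma(\phi)=-\phi$ in the even case) such that $(\phi-\phi^*)\eta(t)$, $(\phi^2-1)\eta(t)$, $[\phi,\eta(t)]$, $(\mathrm{ad}\,V_g(\phi)-\phi)\eta(t)$ are compact for all $t\in A$, $g\in\Pi$. A homotopy of cycles is an analogous bimodule with a Hilbert $C([0,1])$-module in place of $H$, whose evaluations at $0,1$ are, up to unitary equivalence, the given cycles. $K^{0}_\Pi(A)$ (even), $K^1_\Pi(A)$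 (odd) are the homotopy classes of cycles, and $\widetilde K^{0/1}_\Pi(A)$ the classes of cycles with $\Pi$-invariant $\phi$ under homotopies with $\Pi$-invariant operator. **Theorem.** In the even as well as in the odd case ($*=0,1$ respectively): 1. For every localized Fredholm module $(\pi,U,\Gamma,F_a)$ the quadruple $(\pi_*,U_*,\Gamma_a,F_a)$ on $\mathcal H_a$ is a cycle over $A$, where $U_{*,[p]}=U_p$ and $\pi_*:A\to B(\mathcal H_a)$ is the lift of $\pi$ to the enveloping net bundle. Every element of $K^*_\Pi(A)$ is the class of such a cycle. A given cycle $(\eta,V,\Gamma,\phi)$ is, up to unitary equivalence, of this form if and only if $\phi=\phi^*$, $\phi^2-1$ is compact and all $\mathrm{ad}\,V_g(\phi)-\phi$ are compact. Two localized modules are unitarily equivalent if and only if their cycles are. 2. For every Fredholm module $(\pi,U,\Gamma,F)$ the quadruple $(\pi_*,U_*,\Gamma_a,F_a)$ is a cycle with $\Pi$-invariant operator. Every element of $\widetilde K^*_\Pi(A)$ is the class of such a cycle. A given cycle with $\Pi$-invariant operator is, up to unitary equivalence, of this form if and only if $\phi=\phi^*$ and $\phi^2-1$ is compact. Two Fredholm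 modules are unitarily equivalent if and only if their cycles are. -/

import Mathlib

open scoped ComplexOrder ENNReal

universe u w v

noncomputable section

/-! ## Simplices, paths and the fundamental group of a poset -/

/-- A 1-simplex `b` of the poset `K` with 1-face `∂₁b = a` (its starting point) and 0-face
`∂₀b = o` (its end point): a support `|b|` above both faces. -/
structure PosetSimplex {K : Type u} [PartialOrder K] (a o : K) : Type u where
  supp : K
  le₁ : a ≤ supp
  le₀ : o ≤ supp

/-- The opposite 1-simplex. -/
def PosetSimplex.opp {K : Type u} [PartialOrder K] {a o : K} (b : PosetSimplex a o) :
    PosetSimplex o a :=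
  ⟨b.supp, b.le₀, b.le₁⟩

/-- Paths `p = bₙ * ⋯ * b₁ : a → o`, `n ≥ 1`, in a poset. -/
inductive PosetPath {K : Type u} [PartialOrder K] : K → K → Type u
  | single {a o : K} (b : PosetSimplex a o) : PosetPath a o
  | cons {a e o : K} (b : PosetSimplex e o) (p : PosetPath a e) : PosetPath a o

namespace PosetPath

/-- The composition `q * p` (first `p`, then `q`). -/
def comp {K : Type u} [PartialOrder K] {a e o : K} :
    PosetPath e o → PosetPath a e → PosetPath a o
  | single b, p => cons b p
  | cons b q, p => cons b (comp q p)

/-- The opposite path. -/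
def opp {K : Type u} [PartialOrder K] {a o : K} : PosetPath a o → PosetPath o a
  | single b => single b.opp
  | cons b p => comp (opp p) (single b.opp)

/-- The trivial path `(a; a, a)`. -/
def triv {K : Type u} [PartialOrder K] (a : K) : PosetPath a a := single ⟨a, le_rfl, le_rfl⟩

/-- The 1-simplex `(o'; o', o)`, as a path `o → o'`. -/
def ofLE {K : Type u} [PartialOrder K] {o o' : K} (h : o ≤ o') : PosetPath o o' :=
  single ⟨o', h, le_rfl⟩

/-- Homotopy of paths: finitely many elementary deformations, each of which replaces a 1-simplex
`∂₁c` of the path by `∂₀c * ∂₂c`, or conversely, where `c` is a 2-simplex, that is, a triangle of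
1-simplices whose supports all lie below one element `s` of the poset. -/
inductive Homotopy {K : Type u} [PartialOrder K] :
    ∀ {a o : K}, PosetPath a o → PosetPath a o → Prop
  | deform {x y z : K} (b₀ : PosetSimplex y z) (b₁ : PosetSimplex x z) (b₂ : PosetSimplex x y)
      (s : K) (h₀ : b₀.supp ≤ s) (h₁ : b₁.supp ≤ s) (h₂ : b₂.supp ≤ s) :
      Homotopy (single b₁) (cons b₀ (single b₂))
  | refl {a o : K} (p : PosetPath a o) : Homotopy p p
  | symm {a o : K} {p q : PosetPath a o} : Homotopy p q → Homotopy q p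
  | trans {a o : K} {p q r : PosetPath a o} : Homotopy p q → Homotopy q r → Homotopy p r
  | comp {a e o : K} {q q' : PosetPath e o} {p p' : PosetPath a e} :
      Homotopy q q' → Homotopy p p' → Homotopy (comp q p) (comp q' p')

variable {K : Type*} [PartialOrder K]

theorem comp_assoc {a b c d : K} (r : PosetPath c d) (q : PosetPath b c) (p : PosetPath a b) :
    (r.comp q).comp p = r.comp (q.comp p) := by
  induction r with
  | single b => rfl
  | cons b r ih => simp only [comp, ih]

theorem triv_comp {a o : K} (p : PosetPath a o) : Homotopy ((triv o).comp p) p := by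
  cases p with
  | single b =>
    exact (Homotopy.deform ⟨o, le_rfl, le_rfl⟩ b b b.supp b.le₀ le_rfl le_rfl).symm
  | cons b p =>
    have h := (Homotopy.deform ⟨o, le_rfl, le_rfl⟩ b b b.supp b.le₀ le_rfl le_rfl).symm
    exact Homotopy.comp h (Homotopy.refl p)

theorem comp_triv {a o : K} (p : PosetPath a o) : Homotopy (p.comp (triv a)) p := by
  induction p with
  | single b =>
    exact (Homotopy.deform b b ⟨_, le_rfl, le_rfl⟩ b.supp le_rfl le_rfl b.le₁).symm
  | cons b p ih => exact Homotopy.comp (Homotopy.refl (single b)) ih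

theorem opp_comp_self {a o : K} (p : PosetPath a o) : Homotopy (p.opp.comp p) (triv a) := by
  induction p with
  | single b =>
    exact (Homotopy.deform b.opp ⟨_, le_rfl, le_rfl⟩ b b.supp le_rfl b.le₁ le_rfl).symm
  | cons b p ih =>
    simp only [opp, comp_assoc]
    refine Homotopy.trans (Homotopy.comp (Homotopy.refl _) ?_) ih
    have h : Homotopy ((single b.opp).comp (single b)) (triv _) :=
      (Homotopy.deform b.opp ⟨_, le_rfl, le_rfl⟩ b b.supp le_rfl b.le₁ le_rfl).symm
    have h' := Homotopy.comp h (Homotopy.refl p)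
    exact h'.trans (triv_comp p)

theorem opp_comp {a e o : K} (q : PosetPath e o) (p : PosetPath a e) :
    (q.comp p).opp = p.opp.comp q.opp := by
  induction q with
  | single b => rfl
  | cons b q ih => simp only [comp, opp, ih, comp_assoc]

theorem Homotopy.opp {a o : K} {p q : PosetPath a o} (h : Homotopy p q) :
    Homotopy p.opp q.opp := by
  induction h with
  | deform b₀ b₁ b₂ s h₀ h₁ h₂ => exact Homotopy.deform b₂.opp b₁.opp b₀.opp s h₂ h₁ h₀
  | refl p => exact Homotopy.refl _
  | symm _ ih => exact ih.symm
  | trans _ _ ih₁ ih₂ => exact ih₁.trans ih₂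
  | comp _ _ ih₁ ih₂ => rw [opp_comp, opp_comp]; exact Homotopy.comp ih₂ ih₁

/-- Homotopy as an equivalence relation. -/
def homotopySetoid (a o : K) : Setoid (PosetPath a o) where
  r := Homotopy
  iseqv := ⟨Homotopy.refl, Homotopy.symm, Homotopy.trans⟩

end PosetPath

/-- `K` is pathwise connected. -/
def PathwiseConnected (K : Type u) [PartialOrder K] : Prop :=
  ∀ a o : K, Nonempty (PosetPath a o)

/-- The fundamental group `π₁ᵃ(K)`: homotopy classes of loops over `a`. -/
def PosetPi1 {K : Type u} [PartialOrder K] (a : K) : Type u :=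
  Quotient (PosetPath.homotopySetoid a a)

/-- The homotopy class of a loop. -/
def PosetPi1.mk {K : Type u} [PartialOrder K] {a : K} (p : PosetPath a a) : PosetPi1 a :=
  Quotient.mk (PosetPath.homotopySetoid a a) p

instance PosetPi1.instMul {K : Type u} [PartialOrder K] (a : K) : Mul (PosetPi1 a) :=
  ⟨Quotient.map₂ PosetPath.comp fun _ _ h _ _ h' => PosetPath.Homotopy.comp h h'⟩

instance PosetPi1.instInv {K : Type u} [PartialOrder K] (a : K) : Inv (PosetPi1 a) :=
  ⟨Quotient.map PosetPath.opp fun _ _ h => PosetPath.Homotopy.opp h⟩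

instance PosetPi1.instOne {K : Type u} [PartialOrder K] (a : K) : One (PosetPi1 a) :=
  ⟨PosetPi1.mk (PosetPath.triv a)⟩

/-- The group law is `[q][p] = [q * p]`, and `[p]⁻¹` is the class of the opposite loop. -/
instance PosetPi1.instGroup {K : Type u} [PartialOrder K] (a : K) : Group (PosetPi1 a) :=
  Group.ofLeftAxioms
    (by
      rintro ⟨r⟩ ⟨q⟩ ⟨p⟩
      exact congrArg PosetPi1.mk (PosetPath.comp_assoc r q p))
    (by rintro ⟨p⟩; exact Quotient.sound (PosetPath.triv_comp p))
    (by rintro ⟨p⟩; exact Quotient.sound (PosetPath.opp_comp_self p))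

/-! ## Nets of C*-algebras, net bundles and holonomy -/

/-- A net (precosheaf) of unital C*-algebras over `K`: unital *-monomorphisms
`incl : 𝒜_o → 𝒜_o'` for `o ≤ o'`, with `incl_{o''o} = incl_{o''o'} ∘ incl_{o'o}`. -/
structure CStarNet (K : Type u) [PartialOrder K] where
  fiber : K → Type v
  [cstar : ∀ o, CStarAlgebra (fiber o)]
  incl : ∀ {o o' : K}, o ≤ o' → fiber o →⋆ₐ[ℂ] fiber o'
  incl_injective : ∀ {o o' : K} (h : o ≤ o'), Function.Injective (incl h)
  incl_incl : ∀ {o o' o'' : K} (h : o ≤ o') (h' : o' ≤ o'') (x : fiber o),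
    incl h' (incl h x) = incl (h.trans h') x

attribute [instance] CStarNet.cstar

/-- A C*-net bundle: all inclusion maps are *-isomorphisms. No unit is required in the fibres
(for a *-isomorphism between unital C*-algebras, preservation of the unit is automatic). -/
structure CStarNetBundle (K : Type u) [PartialOrder K] where
  fiber : K → Type v
  [cstar : ∀ o, NonUnitalCStarAlgebra (fiber o)]
  incl : ∀ {o o' : K}, o ≤ o' → fiber o ≃⋆ₐ[ℂ] fiber o'
  incl_incl : ∀ {o o' o'' : K} (h : o ≤ o') (h' : o' ≤ o'') (x : fiber o),
    incl h' (incl h x) = incl (h.trans h') x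

attribute [instance] CStarNetBundle.cstar

namespace CStarNetBundle

variable {K : Type*} [PartialOrder K] (𝓑 : CStarNetBundle K)

/-- `𝓑_b = incl_{∂₀b |b|} ∘ incl_{|b| ∂₁b}`, where `incl_{∂₀b |b|}` is the inverse of
`incl_{|b| ∂₀b}`. -/
def alongSimplex {a o : K} (b : PosetSimplex a o) : 𝓑.fiber a ≃⋆ₐ[ℂ] 𝓑.fiber o :=
  (𝓑.incl b.le₁).trans (𝓑.incl b.le₀).symm

/-- Parallel transport along a path `p = bₙ * ⋯ * b₁`: the composition `𝓑_{bₙ} ∘ ⋯ ∘ 𝓑_{b₁}`. -/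
def along {a o : K} : PosetPath a o → (𝓑.fiber a ≃⋆ₐ[ℂ] 𝓑.fiber o)
  | .single b => 𝓑.alongSimplex b
  | .cons b p => (along p).trans (𝓑.alongSimplex b)

theorem along_comp {a e o : K} (q : PosetPath e o) (p : PosetPath a e) :
    𝓑.along (q.comp p) = (𝓑.along p).trans (𝓑.along q) := by
  induction q with
  | single b => rfl
  | cons b q ih => simp only [PosetPath.comp, along, ih]; rfl

theorem alongSimplex_apply_of_le {a o s : K} (b : PosetSimplex a o) (h : b.supp ≤ s)
    (x : 𝓑.fiber a) :
    𝓑.alongSimplex b x =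
      (𝓑.incl (b.le₀.trans h)).symm (𝓑.incl (b.le₁.trans h) x) := by
  apply EquivLike.injective (𝓑.incl (b.le₀.trans h))
  rw [StarAlgEquiv.apply_symm_apply, ← 𝓑.incl_incl b.le₀ h, ← 𝓑.incl_incl b.le₁ h]
  simp [alongSimplex]

theorem along_homotopy {a o : K} {p q : PosetPath a o} (h : PosetPath.Homotopy p q) :
    𝓑.along p = 𝓑.along q := by
  induction h with
  | deform b₀ b₁ b₂ s h₀ h₁ h₂ =>
    ext x
    simp only [along, StarAlgEquiv.trans_apply, 𝓑.alongSimplex_apply_of_le _ h₀,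
      𝓑.alongSimplex_apply_of_le _ h₁, 𝓑.alongSimplex_apply_of_le _ h₂,
      StarAlgEquiv.apply_symm_apply]
  | refl p => rfl
  | symm _ ih => exact ih.symm
  | trans _ _ ih₁ ih₂ => exact ih₁.trans ih₂
  | comp _ _ ih₁ ih₂ => rw [along_comp, along_comp, ih₁, ih₂]

theorem incl_self (o : K) (x : 𝓑.fiber o) : 𝓑.incl (le_refl o) x = x :=
  EquivLike.injective (𝓑.incl (le_refl o)) (𝓑.incl_incl _ _ x)

theorem along_ofLE {o o' : K} (h : o ≤ o') (x : 𝓑.fiber o) :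
    𝓑.along (PosetPath.ofLE h) x = 𝓑.incl h x := by
  change (𝓑.incl (le_refl o')).symm (𝓑.incl h x) = _
  apply EquivLike.injective (𝓑.incl (le_refl o'))
  rw [𝓑.incl_self (o := o') (𝓑.incl h x)]
  exact StarAlgEquiv.apply_symm_apply _ _

theorem along_ofLE_opp {o o' : K} (h : o ≤ o') (x : 𝓑.fiber o') :
    𝓑.along (PosetPath.ofLE h).opp x = (𝓑.incl h).symm x := by
  change (𝓑.incl h).symm (𝓑.incl (le_refl o') x) = _
  rw [𝓑.incl_self]

/-- The holonomy action `[p] ↦ 𝓑_p` of the fundamental group on the fibre over `a`. -/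
def holonomy (a : K) : PosetPi1 a →* (𝓑.fiber a ≃⋆ₐ[ℂ] 𝓑.fiber a) :=
  MonoidHom.mk' (Quotient.lift 𝓑.along fun _ _ h => 𝓑.along_homotopy h)
    (by rintro ⟨q⟩ ⟨p⟩; exact 𝓑.along_comp q p)

end CStarNetBundle

/-- A Hilbert net bundle `(ℋ, U)` over `K`: Hilbert spaces with unitaries `U_{o'o}`. -/
structure HilbertNetBundle (K : Type u) [PartialOrder K] where
  fiber : K → Type v
  [normed : ∀ o, NormedAddCommGroup (fiber o)]
  [inner : ∀ o, InnerProductSpace ℂ (fiber o)]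
  [complete : ∀ o, CompleteSpace (fiber o)]
  U : ∀ {o o' : K}, o ≤ o' → fiber o ≃ₗᵢ[ℂ] fiber o'
  U_U : ∀ {o o' o'' : K} (h : o ≤ o') (h' : o' ≤ o'') (x : fiber o),
    U h' (U h x) = U (h.trans h') x

attribute [instance] HilbertNetBundle.normed HilbertNetBundle.inner HilbertNetBundle.complete

namespace HilbertNetBundle

variable {K : Type*} [PartialOrder K] (ℋ : HilbertNetBundle K)

/-- `U_b = U_{∂₀b |b|} U_{|b| ∂₁b}`. -/
def alongSimplex {a o : K} (b : PosetSimplex a o) : ℋ.fiber a ≃ₗᵢ[ℂ] ℋ.fiber o :=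
  (ℋ.U b.le₁).trans (ℋ.U b.le₀).symm

/-- `U_p = U_{bₙ} ⋯ U_{b₁}`. -/
def along {a o : K} : PosetPath a o → (ℋ.fiber a ≃ₗᵢ[ℂ] ℋ.fiber o)
  | .single b => ℋ.alongSimplex b
  | .cons b p => (along p).trans (ℋ.alongSimplex b)

theorem along_comp {a e o : K} (q : PosetPath e o) (p : PosetPath a e) :
    ℋ.along (q.comp p) = (ℋ.along p).trans (ℋ.along q) := by
  induction q with
  | single b => rfl
  | cons b q ih => simp only [PosetPath.comp, along, ih]; rfl

theorem alongSimplex_apply_of_le {a o s : K} (b : PosetSimplex a o) (h : b.supp ≤ s)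
    (x : ℋ.fiber a) :
    ℋ.alongSimplex b x = (ℋ.U (b.le₀.trans h)).symm (ℋ.U (b.le₁.trans h) x) := by
  apply (ℋ.U (b.le₀.trans h)).injective
  rw [LinearIsometryEquiv.apply_symm_apply, ← ℋ.U_U b.le₀ h, ← ℋ.U_U b.le₁ h]
  simp [alongSimplex]

theorem along_homotopy {a o : K} {p q : PosetPath a o} (h : PosetPath.Homotopy p q) :
    ℋ.along p = ℋ.along q := by
  induction h with
  | deform b₀ b₁ b₂ s h₀ h₁ h₂ =>
    ext x
    simp only [along, LinearIsometryEquiv.trans_apply, ℋ.alongSimplex_apply_of_le _ h₀,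
      ℋ.alongSimplex_apply_of_le _ h₁, ℋ.alongSimplex_apply_of_le _ h₂,
      LinearIsometryEquiv.apply_symm_apply]
  | refl p => rfl
  | symm _ ih => exact ih.symm
  | trans _ _ ih₁ ih₂ => exact ih₁.trans ih₂
  | comp _ _ ih₁ ih₂ => rw [along_comp, along_comp, ih₁, ih₂]

/-- The unitary representation `[p] ↦ U_p` of the fundamental group on `ℋ_a`. -/
def holonomy (a : K) : PosetPi1 a →* (ℋ.fiber a ≃ₗᵢ[ℂ] ℋ.fiber a) :=
  MonoidHom.mk' (Quotient.lift ℋ.along fun _ _ h => ℋ.along_homotopy h)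
    (by rintro ⟨q⟩ ⟨p⟩; exact ℋ.along_comp q p)

/-- The C*-net bundle `(Bℋ, ad U)`. -/
def adBundle : CStarNetBundle K where
  fiber o := ℋ.fiber o →L[ℂ] ℋ.fiber o
  incl h := (ℋ.U h).conjStarAlgEquiv
  incl_incl h h' T := by
    ext x
    simp only [LinearIsometryEquiv.conjStarAlgEquiv_apply_apply, ℋ.U_U]
    congr 2
    apply (ℋ.U (h.trans h')).injective
    rw [LinearIsometryEquiv.apply_symm_apply, ← ℋ.U_U h h']
    simp

end HilbertNetBundle

/-- A morphism from a net of C*-algebras into a C*-net bundle: a family of *-morphisms (not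
required to preserve units) intertwining the inclusion maps. -/
structure NetMorphism {K : Type*} [PartialOrder K] (𝒜 : CStarNet K) (𝓑 : CStarNetBundle K) where
  hom : ∀ o, 𝒜.fiber o →⋆ₙₐ[ℂ] 𝓑.fiber o
  comm : ∀ {o o' : K} (h : o ≤ o') (x : 𝒜.fiber o), 𝓑.incl h (hom o x) = hom o' (𝒜.incl h x)

/-! ## The enveloping net bundle -/

/-- For a map of index sets `f : J → I` and *-morphisms `g j : E (f j) → F j`, the induced
*-morphism of `ℓ^∞`-products, `(x_i) ↦ (g j (x_{f j}))`. -/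
def lpInftyHom {I J : Type*} {E : I → Type*} {F : J → Type*} [∀ i, NonUnitalCStarAlgebra (E i)]
    [∀ j, NonUnitalCStarAlgebra (F j)] (f : J → I) (g : ∀ j, E (f j) →⋆ₙₐ[ℂ] F j) :
    lp E ∞ →⋆ₙₐ[ℂ] lp F ∞ where
  toFun x := ⟨fun j => g j (x (f j)), memℓp_infty ⟨‖x‖, by
    rintro _ ⟨j, rfl⟩
    exact (NonUnitalStarAlgHom.norm_apply_le (g j) _).trans
      (lp.norm_apply_le_norm ENNReal.top_ne_zero x (f j))⟩⟩
  map_smul' c x := by ext j; simp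
  map_zero' := by ext j; simp
  map_add' x y := by ext j; exact map_add (g j) _ _
  map_mul' x y := by ext j; simp [lp.infty_coeFn_mul]
  map_star' x := by ext j; simp [map_star]

namespace CStarNet

/-- All pairs of a C*-net bundle and a morphism from the net `𝒜` into it. -/
structure Target {K : Type u} [PartialOrder K] (𝒜 : CStarNet.{u, u} K) where
  bundle : CStarNetBundle.{u, u} K
  mor : NetMorphism 𝒜 bundle

variable {K : Type u} [PartialOrder K] (𝒜 : CStarNet.{u, u} K)

/-- The product over all targets of the fibres over `a`. -/
abbrev TargetProd (a : K) : Type (u + 1) :=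
  lp (fun τ : 𝒜.Target => τ.bundle.fiber a) ∞

/-- The elements `(p, t)`, `p : o → a`, `t ∈ 𝒜_o`, of the product: the component at a target
`(𝓑, ψ)` is `𝓑_p (ψ_o t)`. -/
def canonicalElem {a o : K} (p : PosetPath o a) (t : 𝒜.fiber o) : 𝒜.TargetProd a :=
  ⟨fun τ => τ.bundle.along p (τ.mor.hom o t), memℓp_infty ⟨‖t‖, by
    rintro _ ⟨τ, rfl⟩
    exact (NonUnitalStarAlgHom.norm_apply_le (τ.bundle.along p) _).trans
      (NonUnitalStarAlgHom.norm_apply_le (τ.mor.hom o) t)⟩⟩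

/-- The fibre over `a` of the enveloping net bundle: the C*-algebra generated by the elements
`(p, t)`. -/
def envelopeAlg (a : K) : NonUnitalStarSubalgebra ℂ (𝒜.TargetProd a) :=
  (NonUnitalStarAlgebra.adjoin ℂ
    {x | ∃ (o : K) (p : PosetPath o a) (t : 𝒜.fiber o), x = 𝒜.canonicalElem p t}).topologicalClosure

theorem isClosed_envelopeAlg (a : K) : IsClosed (𝒜.envelopeAlg a : Set (𝒜.TargetProd a)) :=
  NonUnitalStarSubalgebra.isClosed_topologicalClosure _

instance (a : K) : NonUnitalCStarAlgebra (𝒜.envelopeAlg a) :=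
  NonUnitalStarSubalgebra.nonUnitalCStarAlgebra _ (h_closed := 𝒜.isClosed_envelopeAlg a)

theorem canonicalElem_mem {a o : K} (p : PosetPath o a) (t : 𝒜.fiber o) :
    𝒜.canonicalElem p t ∈ 𝒜.envelopeAlg a :=
  NonUnitalStarSubalgebra.le_topologicalClosure _
    (NonUnitalStarAlgebra.subset_adjoin ℂ _ ⟨o, p, t, rfl⟩)

/-- A property of elements of the enveloping algebra which is closed and stable under the
operations holds as soon as it holds for the generators. -/
theorem envelopeAlg_le {a : K} (S : NonUnitalStarSubalgebra ℂ (𝒜.TargetProd a))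
    (hS : IsClosed (S : Set (𝒜.TargetProd a)))
    (h : ∀ (o : K) (p : PosetPath o a) (t : 𝒜.fiber o), 𝒜.canonicalElem p t ∈ S) :
    𝒜.envelopeAlg a ≤ S := by
  refine NonUnitalStarSubalgebra.topologicalClosure_minimal _ (NonUnitalStarAlgebra.adjoin_le ?_) hS
  rintro _ ⟨o, p, t, rfl⟩
  exact h o p t

theorem map_envelopeAlg {a b : K} (Φ : 𝒜.TargetProd a →⋆ₙₐ[ℂ] 𝒜.TargetProd b)
    (h : ∀ (o : K) (p : PosetPath o a) (t : 𝒜.fiber o), Φ (𝒜.canonicalElem p t) ∈ 𝒜.envelopeAlg b)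
    (x : 𝒜.envelopeAlg a) : Φ x ∈ 𝒜.envelopeAlg b :=
  𝒜.envelopeAlg_le ((𝒜.envelopeAlg b).comap Φ)
    ((𝒜.isClosed_envelopeAlg b).preimage
      (AddMonoidHomClass.continuous_of_bound Φ 1 fun y => by
        simpa using NonUnitalStarAlgHom.norm_apply_le Φ y)) h x.2

/-- The restriction of a *-morphism of the products to the enveloping algebras. -/
def restrict {a b : K} (Φ : 𝒜.TargetProd a →⋆ₙₐ[ℂ] 𝒜.TargetProd b)
    (h : ∀ (o : K) (p : PosetPath o a) (t : 𝒜.fiber o),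
      Φ (𝒜.canonicalElem p t) ∈ 𝒜.envelopeAlg b) :
    𝒜.envelopeAlg a →⋆ₙₐ[ℂ] 𝒜.envelopeAlg b where
  toFun x := ⟨Φ x, 𝒜.map_envelopeAlg Φ h x⟩
  map_smul' c x := Subtype.ext (map_smul Φ c (x : 𝒜.TargetProd a))
  map_zero' := Subtype.ext (map_zero Φ)
  map_add' x y := Subtype.ext (map_add Φ (x : 𝒜.TargetProd a) y)
  map_mul' x y := Subtype.ext (map_mul Φ (x : 𝒜.TargetProd a) y)
  map_star' x := Subtype.ext (map_star Φ (x : 𝒜.TargetProd a))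

/-- The componentwise inclusion maps of the enveloping net bundle. -/
def envelopeIncl {o o' : K} (h : o ≤ o') : 𝒜.envelopeAlg o →⋆ₙₐ[ℂ] 𝒜.envelopeAlg o' :=
  𝒜.restrict
    (lpInftyHom (E := fun τ : 𝒜.Target => τ.bundle.fiber o)
      (F := fun τ : 𝒜.Target => τ.bundle.fiber o') id
      fun τ => (τ.bundle.incl h : τ.bundle.fiber o →⋆ₙₐ[ℂ] τ.bundle.fiber o'))
    fun e p t => by
      convert 𝒜.canonicalElem_mem ((PosetPath.ofLE h).comp p) t
      ext τ
      change τ.bundle.incl h (τ.bundle.along p _) = τ.bundle.along _ _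
      rw [CStarNetBundle.along_comp, StarAlgEquiv.trans_apply, CStarNetBundle.along_ofLE]
      rfl

/-- The inverses of the inclusion maps. -/
def envelopeInclInv {o o' : K} (h : o ≤ o') : 𝒜.envelopeAlg o' →⋆ₙₐ[ℂ] 𝒜.envelopeAlg o :=
  𝒜.restrict
    (lpInftyHom (E := fun τ : 𝒜.Target => τ.bundle.fiber o')
      (F := fun τ : 𝒜.Target => τ.bundle.fiber o) id
      fun τ => ((τ.bundle.incl h).symm : τ.bundle.fiber o' →⋆ₙₐ[ℂ] τ.bundle.fiber o))
    fun e p t => by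
      convert 𝒜.canonicalElem_mem ((PosetPath.ofLE h).opp.comp p) t
      ext τ
      change (τ.bundle.incl h).symm (τ.bundle.along p _) = τ.bundle.along _ _
      rw [CStarNetBundle.along_comp, StarAlgEquiv.trans_apply, CStarNetBundle.along_ofLE_opp]
      rfl

/-- The enveloping C*-net bundle `(𝒜̄, ȷ̄)` of the net. -/
def envelope : CStarNetBundle.{u, u + 1} K where
  fiber a := 𝒜.envelopeAlg a
  incl h :=
    { toFun := 𝒜.envelopeIncl h
      invFun := 𝒜.envelopeInclInv h
      left_inv := fun x =>
        Subtype.ext (lp.ext (funext fun τ => (τ.bundle.incl h).symm_apply_apply (x.1 τ)))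
      right_inv := fun x =>
        Subtype.ext (lp.ext (funext fun τ => (τ.bundle.incl h).apply_symm_apply (x.1 τ)))
      map_mul' := map_mul (𝒜.envelopeIncl h)
      map_add' := map_add (𝒜.envelopeIncl h)
      map_star' := map_star (𝒜.envelopeIncl h)
      map_smul' := map_smul (𝒜.envelopeIncl h) }
  incl_incl h h' x :=
    Subtype.ext (lp.ext (funext fun τ => τ.bundle.incl_incl h h' (x.1 τ)))

theorem canonicalElem_triv_apply {o : K} (t : 𝒜.fiber o) (τ : 𝒜.Target) :
    𝒜.canonicalElem (PosetPath.triv o) t τ = τ.mor.hom o t := by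
  change τ.bundle.along (PosetPath.ofLE le_rfl) (τ.mor.hom o t) = _
  rw [CStarNetBundle.along_ofLE, CStarNetBundle.incl_self]

/-- The canonical morphism `ε` of the net into its enveloping net bundle; its component at a
target `(𝓑, ψ)` is `ψ`. -/
def canonicalMor : NetMorphism 𝒜 𝒜.envelope where
  hom o :=
    { toFun := fun t => ⟨𝒜.canonicalElem (PosetPath.triv o) t, 𝒜.canonicalElem_mem _ t⟩
      map_smul' := fun c t => Subtype.ext (lp.ext (funext fun τ => by
        change τ.bundle.along _ (τ.mor.hom o (c • t)) = c • τ.bundle.along _ (τ.mor.hom o t)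
        rw [map_smul, map_smul]))
      map_zero' := Subtype.ext (lp.ext (funext fun τ => by
        change τ.bundle.along _ (τ.mor.hom o 0) = 0
        rw [map_zero, map_zero]))
      map_add' := fun s t => Subtype.ext (lp.ext (funext fun τ => by
        change τ.bundle.along _ (τ.mor.hom o (s + t)) =
          τ.bundle.along _ (τ.mor.hom o s) + τ.bundle.along _ (τ.mor.hom o t)
        rw [map_add, map_add]))
      map_mul' := fun s t => Subtype.ext (lp.ext (funext fun τ => by
        change τ.bundle.along _ (τ.mor.hom o (s * t)) =
          τ.bundle.along _ (τ.mor.hom o s) * τ.bundle.along _ (τ.mor.hom o t)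
        rw [map_mul, map_mul]))
      map_star' := fun t => Subtype.ext (lp.ext (funext fun τ => by
        change τ.bundle.along _ (τ.mor.hom o (star t)) =
          star (τ.bundle.along _ (τ.mor.hom o t))
        rw [map_star, map_star])) }
  comm h t := Subtype.ext (lp.ext (funext fun τ => by
    change τ.bundle.incl h (𝒜.canonicalElem (PosetPath.triv _) t τ) =
      𝒜.canonicalElem (PosetPath.triv _) (𝒜.incl h t) τ
    rw [canonicalElem_triv_apply, canonicalElem_triv_apply]
    exact τ.mor.comm h t))

/-- The lift `𝒜̄_a → 𝓑_a` of a morphism `ψ : 𝒜 → 𝓑` to the enveloping net bundle: the component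
at the target `(𝓑, ψ)`. -/
def lift {𝓑 : CStarNetBundle.{u, u} K} (ψ : NetMorphism 𝒜 𝓑) (a : K) :
    𝒜.envelope.fiber a →⋆ₙₐ[ℂ] 𝓑.fiber a where
  toFun x := x.1 ⟨𝓑, ψ⟩
  map_smul' _ _ := rfl
  map_zero' := rfl
  map_add' _ _ := rfl
  map_mul' _ _ := rfl
  map_star' _ := rfl

/-- `ȷ̄_p (ε_o t)` is the element `(p, t)`. -/
theorem along_canonicalMor {a o : K} (p : PosetPath o a) (t : 𝒜.fiber o) :
    (𝒜.envelope.along p (𝒜.canonicalMor.hom o t)).1 = 𝒜.canonicalElem p t := by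
  have key : ∀ {b c : K} (q : PosetPath b c) (x : 𝒜.envelope.fiber b) (τ : 𝒜.Target),
      (𝒜.envelope.along q x).1 τ = τ.bundle.along q (x.1 τ) := by
    intro b c q
    induction q with
    | single b =>
      intro x τ
      rfl
    | cons b q ih =>
      intro x τ
      exact congrArg (τ.bundle.alongSimplex b) (ih x τ)
  ext τ
  rw [key]
  exact congrArg (τ.bundle.along p) (𝒜.canonicalElem_triv_apply t τ)

/-- A *-morphism on a fibre of the enveloping net bundle is determined by the elements
`ȷ̄_p (ε_o t)`. -/
theorem envelope_hom_ext {B : Type*} [NonUnitalCStarAlgebra B] {a : K}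
    {Φ Ψ : 𝒜.envelope.fiber a →⋆ₙₐ[ℂ] B}
    (h : ∀ (o : K) (p : PosetPath o a) (t : 𝒜.fiber o),
      Φ (𝒜.envelope.along p (𝒜.canonicalMor.hom o t)) =
        Ψ (𝒜.envelope.along p (𝒜.canonicalMor.hom o t))) : Φ = Ψ := by
  have hc : ∀ Θ : 𝒜.envelope.fiber a →⋆ₙₐ[ℂ] B, Continuous Θ := fun Θ =>
    AddMonoidHomClass.continuous_of_bound Θ 1 fun y => by
      simpa using NonUnitalStarAlgHom.norm_apply_le Θ y
  let E : NonUnitalStarSubalgebra ℂ (𝒜.envelopeAlg a) := NonUnitalStarAlgHom.equalizer Φ Ψ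
  have hE : IsClosed (E : Set (𝒜.envelopeAlg a)) := isClosed_eq (hc Φ) (hc Ψ)
  let S : NonUnitalStarSubalgebra ℂ (𝒜.TargetProd a) :=
    E.map (NonUnitalStarSubalgebraClass.subtype (𝒜.envelopeAlg a))
  have hS : IsClosed (S : Set (𝒜.TargetProd a)) :=
    (𝒜.isClosed_envelopeAlg a).isClosedEmbedding_subtypeVal.isClosedMap _ hE
  have hle : 𝒜.envelopeAlg a ≤ S := 𝒜.envelopeAlg_le S hS fun o p t =>
    ⟨𝒜.envelope.along p (𝒜.canonicalMor.hom o t), h o p t, 𝒜.along_canonicalMor p t⟩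
  ext x
  obtain ⟨y, hy, hyx⟩ := hle x.2
  have : y = x := Subtype.ext hyx
  rw [← this]
  exact hy

/-- The universal property of the enveloping net bundle: every morphism of the net into a
C*-net bundle lifts uniquely to a morphism of net bundles. -/
theorem envelope_universal {𝓑 : CStarNetBundle.{u, u} K} (ψ : NetMorphism 𝒜 𝓑) :
    ∃! Ψ : ∀ a, 𝒜.envelope.fiber a →⋆ₙₐ[ℂ] 𝓑.fiber a,
      (∀ (a a' : K) (h : a ≤ a') (x : 𝒜.envelope.fiber a),
        𝓑.incl h (Ψ a x) = Ψ a' (𝒜.envelope.incl h x)) ∧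
      ∀ (a : K) (t : 𝒜.fiber a), Ψ a (𝒜.canonicalMor.hom a t) = ψ.hom a t := by
  refine ⟨𝒜.lift ψ, ⟨fun a a' h x => rfl, fun a t => 𝒜.canonicalElem_triv_apply t ⟨𝓑, ψ⟩⟩, ?_⟩
  rintro Ψ ⟨h₁, h₂⟩
  have key : ∀ (Θ : ∀ a, 𝒜.envelope.fiber a →⋆ₙₐ[ℂ] 𝓑.fiber a),
      (∀ (a a' : K) (h : a ≤ a') (x : 𝒜.envelope.fiber a),
        𝓑.incl h (Θ a x) = Θ a' (𝒜.envelope.incl h x)) →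
      ∀ {b c : K} (q : PosetPath b c) (x : 𝒜.envelope.fiber b),
        Θ c (𝒜.envelope.along q x) = 𝓑.along q (Θ b x) := by
    intro Θ hΘ b c q
    have hs : ∀ {b c : K} (q : PosetSimplex b c) (x : 𝒜.envelope.fiber b),
        Θ c (𝒜.envelope.alongSimplex q x) = 𝓑.alongSimplex q (Θ b x) := by
      intro b c q x
      apply EquivLike.injective (𝓑.incl q.le₀)
      refine (hΘ _ _ q.le₀ _).trans ?_
      refine (congrArg (Θ q.supp) (StarAlgEquiv.apply_symm_apply _ _)).trans ?_
      refine (hΘ _ _ q.le₁ x).symm.trans ?_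
      exact (StarAlgEquiv.apply_symm_apply (𝓑.incl q.le₀) _).symm
    induction q with
    | single b => exact hs b
    | cons b q ih =>
      intro x
      exact (hs b _).trans (congrArg (𝓑.alongSimplex b) (ih x))
  funext a
  refine 𝒜.envelope_hom_ext fun o p t => ?_
  rw [key Ψ h₁, key (𝒜.lift ψ) (fun a a' h x => rfl), h₂]
  exact congrArg (𝓑.along p) (𝒜.canonicalElem_triv_apply t ⟨𝓑, ψ⟩).symm

/-- A period 2 automorphism `β` of the net; the net is ungraded if `β` is the identity. -/
structure Grading {K : Type u} [PartialOrder K] (𝒜 : CStarNet.{u, u} K) where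
  aut : ∀ o, 𝒜.fiber o ≃⋆ₐ[ℂ] 𝒜.fiber o
  comm : ∀ {o o' : K} (h : o ≤ o') (t : 𝒜.fiber o), 𝒜.incl h (aut o t) = aut o' (𝒜.incl h t)
  sq : ∀ (o : K) (t : 𝒜.fiber o), aut o (aut o t) = t

variable {𝒜}

/-- The net is ungraded. -/
def Grading.IsTrivial (β : 𝒜.Grading) : Prop := ∀ (o : K) (t : 𝒜.fiber o), β.aut o t = t

/-- The target `(𝓑, ψ ∘ β)`. -/
def Grading.twist (β : 𝒜.Grading) (τ : 𝒜.Target) : 𝒜.Target where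
  bundle := τ.bundle
  mor :=
    { hom := fun o => (τ.mor.hom o).comp (β.aut o : 𝒜.fiber o →⋆ₙₐ[ℂ] 𝒜.fiber o)
      comm := fun h t => (τ.mor.comm h _).trans (congrArg (τ.mor.hom _) (β.comm h t)) }

/-- The *-morphism of `𝒜̄_a` with `(p, t) ↦ (p, β t)`. -/
def Grading.envelopeHom (β : 𝒜.Grading) (a : K) : 𝒜.envelopeAlg a →⋆ₙₐ[ℂ] 𝒜.envelopeAlg a :=
  𝒜.restrict
    (lpInftyHom (E := fun τ : 𝒜.Target => τ.bundle.fiber a)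
      (F := fun τ : 𝒜.Target => τ.bundle.fiber a) β.twist
      fun τ => NonUnitalStarAlgHom.id ℂ (τ.bundle.fiber a))
    fun _ p t => 𝒜.canonicalElem_mem p (β.aut _ t)

theorem Grading.envelopeHom_envelopeHom (β : 𝒜.Grading) (a : K) (x : 𝒜.envelopeAlg a) :
    β.envelopeHom a (β.envelopeHom a x) = x := by
  refine Subtype.ext (lp.ext (funext fun τ => ?_))
  have h : ∀ (ψ : NetMorphism 𝒜 τ.bundle), ψ = τ.mor →
      (x.1 ⟨τ.bundle, ψ⟩ : τ.bundle.fiber a) = x.1 τ := by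
    rintro ψ rfl
    rfl
  refine h (β.twist (β.twist τ)).mor ?_
  obtain ⟨𝓑, ⟨f, hf⟩⟩ := τ
  have hfun : ∀ o, ((f o).comp (β.aut o : 𝒜.fiber o →⋆ₙₐ[ℂ] 𝒜.fiber o)).comp
      (β.aut o : 𝒜.fiber o →⋆ₙₐ[ℂ] 𝒜.fiber o) = f o := fun o => by
    ext t
    exact congrArg (f o) (β.sq o t)
  simp only [Grading.twist, hfun]

/-- The grading `β_*` induced on the fibre `𝒜̄_a` of the enveloping net bundle. -/
def Grading.envelopeAut (β : 𝒜.Grading) (a : K) :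
    𝒜.envelope.fiber a ≃⋆ₐ[ℂ] 𝒜.envelope.fiber a where
  toFun := β.envelopeHom a
  invFun := β.envelopeHom a
  left_inv := β.envelopeHom_envelopeHom a
  right_inv := β.envelopeHom_envelopeHom a
  map_mul' := map_mul (β.envelopeHom a)
  map_add' := map_add (β.envelopeHom a)
  map_star' := map_star (β.envelopeHom a)
  map_smul' := map_smul (β.envelopeHom a)

theorem Grading.envelopeAut_canonicalMor (β : 𝒜.Grading) (a : K) (t : 𝒜.fiber a) :
    β.envelopeAut a (𝒜.canonicalMor.hom a t) = 𝒜.canonicalMor.hom a (β.aut a t) :=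
  rfl

end CStarNet

/-! ## Equivariant K-homology -/

/-- `T ∈ K(H)`. -/
abbrev IsCompactOp {H : Type*} [NormedAddCommGroup H] [InnerProductSpace ℂ H] (T : H →L[ℂ] H) :
    Prop :=
  IsCompactOperator T

/-- The data of a Kasparov `A`-`ℂ`-bimodule with an action of `G`: a Hilbert space `H` with a
representation `η` of `A`, unitaries `V g`, a grading unitary `Γ` and a bounded operator `φ`. -/
structure KasparovDatum (A : Type w) [NonUnitalCStarAlgebra A] (G : Type v) [Group G] :
    Type (max (u + 1) w v) where
  H : Type u
  [normed : NormedAddCommGroup H]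
  [inner : InnerProductSpace ℂ H]
  [complete : CompleteSpace H]
  η : A →⋆ₙₐ[ℂ] (H →L[ℂ] H)
  V : G →* (H ≃ₗᵢ[ℂ] H)
  Γ : H ≃ₗᵢ[ℂ] H
  φ : H →L[ℂ] H

attribute [instance] KasparovDatum.normed KasparovDatum.inner KasparovDatum.complete

/-- The axioms of an even (`i = 0`) or odd (`i = 1`) equivariant Kasparov `A`-`ℂ`-bimodule (a
cycle of `K^i_G(A)`), for the action `α` of the discrete group `G` and the grading `γ` of `A`.
In the even case `φ` is odd for `Γ`; in the odd case nothing is graded (`Γ = 1`, to be used with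
`γ = id`). The commutator `φ η(t) - η(γ t) φ` of the odd operator `φ` is the graded one, which for
`γ = id` is the ordinary commutator. -/
structure KasparovDatum.IsCycle {A : Type*} [NonUnitalCStarAlgebra A] {G : Type*} [Group G]
    (α : G →* (A ≃⋆ₐ[ℂ] A)) (γ : A ≃⋆ₐ[ℂ] A) (i : Fin 2) (d : KasparovDatum A G) : Prop where
  covariant : ∀ (g : G) (t : A), d.η (α g t) = (d.V g).conjStarAlgEquiv (d.η t)
  grading_sq : ∀ x : d.H, d.Γ (d.Γ x) = x
  grading_comm : ∀ (g : G) (x : d.H), d.V g (d.Γ x) = d.Γ (d.V g x)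
  graded : ∀ t : A, d.η (γ t) = d.Γ.conjStarAlgEquiv (d.η t)
  even : i = 0 → d.Γ.conjStarAlgEquiv d.φ = -d.φ
  odd : i = 1 → ∀ x : d.H, d.Γ x = x
  compact_selfAdjoint : ∀ t : A, IsCompactOp ((d.φ - star d.φ) * d.η t)
  compact_sq : ∀ t : A, IsCompactOp ((d.φ * d.φ - 1) * d.η t)
  compact_comm : ∀ t : A, IsCompactOp (d.φ * d.η t - d.η (γ t) * d.φ)
  compact_equivariant : ∀ (g : G) (t : A),
    IsCompactOp (((d.V g).conjStarAlgEquiv d.φ - d.φ) * d.η t)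

/-- `g φ = φ` for all `g`. -/
def KasparovDatum.IsInvariant {A : Type*} [NonUnitalCStarAlgebra A] {G : Type*} [Group G]
    (d : KasparovDatum A G) : Prop :=
  ∀ g : G, (d.V g).conjStarAlgEquiv d.φ = d.φ

/-- Unitary equivalence. -/
def KasparovDatum.UnitarilyEquiv {A : Type w} [NonUnitalCStarAlgebra A] {G : Type v}
    [Group G] (d d' : KasparovDatum.{u, w, v} A G) : Prop :=
  ∃ W : d.H ≃ₗᵢ[ℂ] d'.H,
    (∀ (t : A) (x : d.H), W (d.η t x) = d'.η t (W x)) ∧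
    (∀ (g : G) (x : d.H), W (d.V g x) = d'.V g (W x)) ∧
    (∀ x : d.H, W (d.Γ x) = d'.Γ (W x)) ∧
    (∀ x : d.H, W (d.φ x) = d'.φ (W x))

/-- The ideal of compact module operators of a Hilbert `B`-module `E`: the norm closure of the
span of the operators `z ↦ x ⟨y, z⟩`. -/
def compactModuleOperators (B E : Type*) [NormedRing B] [StarRing B] [NormedAlgebra ℂ B]
    [PartialOrder B] [NormedAddCommGroup E] [NormedSpace ℂ E] [SMul B E] [CStarModule B E] :
    Set (E →L[ℂ] E) :=
  closure (Submodule.span ℂ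
    {T : E →L[ℂ] E | ∃ x y : E, ∀ z : E, T z = (inner B y z : B) • x} : Set (E →L[ℂ] E))

/-- The data of a Kasparov `A`-`C([0,1])`-bimodule with an action of `G` (`C([0,1])` having
trivial action and grading). The operators are adjointable, hence module maps: `φ` comes with its
adjoint `φadj`, and `V g`, `Γ` are unitary. -/
structure KasparovFamily (A : Type w) [NonUnitalCStarAlgebra A] (G : Type v) [Group G] :
    Type (max (u + 1) w v) where
  E : Type u
  [normed : NormedAddCommGroup E]
  [space : NormedSpace ℂ E]
  [complete : CompleteSpace E]
  [smul : SMul C(unitInterval, ℂ) E]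
  [hilbert : CStarModule C(unitInterval, ℂ) E]
  η : A →ₙₐ[ℂ] (E →L[ℂ] E)
  η_star : ∀ (t : A) (x y : E),
    inner C(unitInterval, ℂ) (η t x) y = inner C(unitInterval, ℂ) x (η (star t) y)
  V : G →* (E ≃ₗᵢ[ℂ] E)
  V_inner : ∀ (g : G) (x y : E),
    inner C(unitInterval, ℂ) (V g x) (V g y) = inner C(unitInterval, ℂ) x y
  Γ : E ≃ₗᵢ[ℂ] E
  Γ_inner : ∀ x y : E, inner C(unitInterval, ℂ) (Γ x) (Γ y) = inner C(unitInterval, ℂ) x y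
  φ : E →L[ℂ] E
  φadj : E →L[ℂ] E
  φ_adj : ∀ x y : E, inner C(unitInterval, ℂ) (φ x) y = inner C(unitInterval, ℂ) x (φadj y)

attribute [instance] KasparovFamily.normed KasparovFamily.space KasparovFamily.complete
  KasparovFamily.smul KasparovFamily.hilbert

namespace KasparovFamily

variable {A : Type*} [NonUnitalCStarAlgebra A] {G : Type*} [Group G]

/-- The transform `g φ = V g φ (V g)⁻¹`. -/
def transform (𝓔 : KasparovFamily A G) (W : 𝓔.E ≃ₗᵢ[ℂ] 𝓔.E) (T : 𝓔.E →L[ℂ] 𝓔.E) :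
    𝓔.E →L[ℂ] 𝓔.E :=
  (W : 𝓔.E →L[ℂ] 𝓔.E) ∘L T ∘L (W.symm : 𝓔.E →L[ℂ] 𝓔.E)

/-- The axioms of an even/odd equivariant Kasparov `A`-`C([0,1])`-bimodule, that is, of a homotopy
of cycles. -/
structure IsCycle (α : G →* (A ≃⋆ₐ[ℂ] A)) (γ : A ≃⋆ₐ[ℂ] A) (i : Fin 2)
    (𝓔 : KasparovFamily A G) : Prop where
  covariant : ∀ (g : G) (t : A), 𝓔.η (α g t) = 𝓔.transform (𝓔.V g) (𝓔.η t)
  grading_sq : ∀ x : 𝓔.E, 𝓔.Γ (𝓔.Γ x) = x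
  grading_comm : ∀ (g : G) (x : 𝓔.E), 𝓔.V g (𝓔.Γ x) = 𝓔.Γ (𝓔.V g x)
  graded : ∀ t : A, 𝓔.η (γ t) = 𝓔.transform 𝓔.Γ (𝓔.η t)
  even : i = 0 → 𝓔.transform 𝓔.Γ 𝓔.φ = -𝓔.φ
  odd : i = 1 → ∀ x : 𝓔.E, 𝓔.Γ x = x
  compact_selfAdjoint : ∀ t : A,
    (𝓔.φ - 𝓔.φadj) * 𝓔.η t ∈ compactModuleOperators C(unitInterval, ℂ) 𝓔.E
  compact_sq : ∀ t : A,
    (𝓔.φ * 𝓔.φ - 1) * 𝓔.η t ∈ compactModuleOperators C(unitInterval, ℂ) 𝓔.E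
  compact_comm : ∀ t : A,
    𝓔.φ * 𝓔.η t - 𝓔.η (γ t) * 𝓔.φ ∈ compactModuleOperators C(unitInterval, ℂ) 𝓔.E
  compact_equivariant : ∀ (g : G) (t : A),
    (𝓔.transform (𝓔.V g) 𝓔.φ - 𝓔.φ) * 𝓔.η t ∈ compactModuleOperators C(unitInterval, ℂ) 𝓔.E

/-- `g φ = φ` for all `g`. -/
def IsInvariant (𝓔 : KasparovFamily A G) : Prop :=
  ∀ g : G, 𝓔.transform (𝓔.V g) 𝓔.φ = 𝓔.φ

/-- The evaluation of the family at `s ∈ [0,1]` is (unitarily equivalent to) `d`. Here a unitary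
`E ⊗_{ev_s} ℂ ≅ H` is given as the map `q : E → H` with dense range for which
`⟨q x, q y⟩ = ⟨x, y⟩(s)`. -/
def EvaluatesTo (𝓔 : KasparovFamily A G) (s : unitInterval) (d : KasparovDatum A G) : Prop :=
  ∃ q : 𝓔.E →ₗ[ℂ] d.H, DenseRange q ∧
    (∀ x y : 𝓔.E, inner ℂ (q x) (q y) = (inner C(unitInterval, ℂ) x y : C(unitInterval, ℂ)) s) ∧
    (∀ (t : A) (x : 𝓔.E), q (𝓔.η t x) = d.η t (q x)) ∧
    (∀ (g : G) (x : 𝓔.E), q (𝓔.V g x) = d.V g (q x)) ∧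
    (∀ x : 𝓔.E, q (𝓔.Γ x) = d.Γ (q x)) ∧
    (∀ x : 𝓔.E, q (𝓔.φ x) = d.φ (q x))

end KasparovFamily

section KHomology

variable {A : Type w} [NonUnitalCStarAlgebra A] {G : Type v} [Group G]

/-- Homotopy of cycles. -/
def KasparovHomotopic (α : G →* (A ≃⋆ₐ[ℂ] A)) (γ : A ≃⋆ₐ[ℂ] A) (i : Fin 2)
    (d₀ d₁ : KasparovDatum.{u, w, v} A G) : Prop :=
  ∃ 𝓔 : KasparovFamily.{u, w, v} A G,
    𝓔.IsCycle α γ i ∧ 𝓔.EvaluatesTo 0 d₀ ∧ 𝓔.EvaluatesTo 1 d₁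

/-- Homotopy of invariant cycles through invariant cycles. -/
def KasparovStronglyHomotopic (α : G →* (A ≃⋆ₐ[ℂ] A)) (γ : A ≃⋆ₐ[ℂ] A) (i : Fin 2)
    (d₀ d₁ : KasparovDatum.{u, w, v} A G) : Prop :=
  ∃ 𝓔 : KasparovFamily.{u, w, v} A G,
    𝓔.IsCycle α γ i ∧ 𝓔.IsInvariant ∧ 𝓔.EvaluatesTo 0 d₀ ∧ 𝓔.EvaluatesTo 1 d₁

/-- The elements of the equivariant K-homology `K^i_G(A)`: homotopy classes of cycles. -/
def EquivariantKHomology (α : G →* (A ≃⋆ₐ[ℂ] A)) (γ : A ≃⋆ₐ[ℂ] A) (i : Fin 2) :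
    Type (max (u + 1) w v) :=
  Quot fun d₀ d₁ : {d : KasparovDatum.{u, w, v} A G // d.IsCycle α γ i} =>
    KasparovHomotopic α γ i d₀.1 d₁.1

/-- The class of a cycle. -/
def EquivariantKHomology.mk (α : G →* (A ≃⋆ₐ[ℂ] A)) (γ : A ≃⋆ₐ[ℂ] A) (i : Fin 2)
    (d : KasparovDatum.{u, w, v} A G) (hd : d.IsCycle α γ i) :
    EquivariantKHomology.{u, w, v} α γ i :=
  Quot.mk _ ⟨d, hd⟩

/-- The elements of the strongly equivariant K-homology: classes of cycles with invariant operator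
under homotopy through such cycles. -/
def StrongKHomology (α : G →* (A ≃⋆ₐ[ℂ] A)) (γ : A ≃⋆ₐ[ℂ] A) (i : Fin 2) :
    Type (max (u + 1) w v) :=
  Quot fun d₀ d₁ : {d : KasparovDatum.{u, w, v} A G // d.IsCycle α γ i ∧ d.IsInvariant} =>
    KasparovStronglyHomotopic α γ i d₀.1 d₁.1

/-- The class of an invariant cycle. -/
def StrongKHomology.mk (α : G →* (A ≃⋆ₐ[ℂ] A)) (γ : A ≃⋆ₐ[ℂ] A) (i : Fin 2)
    (d : KasparovDatum.{u, w, v} A G) (hd : d.IsCycle α γ i) (hd' : d.IsInvariant) :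
    StrongKHomology.{u, w, v} α γ i :=
  Quot.mk _ ⟨d, hd, hd'⟩

end KHomology

/-! ## Fredholm modules over a net -/

/-- A graded representation of the graded net `(𝒜, β)`: a representation `π` on a Hilbert net
bundle with a grading `Γ`, intertwining `β` and `ad Γ`. -/
structure GradedRepresentation {K : Type u} [PartialOrder K] (𝒜 : CStarNet.{u, u} K)
    (β : 𝒜.Grading) where
  bundle : HilbertNetBundle.{u, u} K
  Γ : ∀ o, bundle.fiber o ≃ₗᵢ[ℂ] bundle.fiber o
  Γ_sq : ∀ (o : K) (x : bundle.fiber o), Γ o (Γ o x) = x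
  Γ_comm : ∀ {o o' : K} (h : o ≤ o') (x : bundle.fiber o),
    Γ o' (bundle.U h x) = bundle.U h (Γ o x)
  rep : NetMorphism 𝒜 bundle.adBundle
  graded : ∀ (o : K) (t : 𝒜.fiber o),
    rep.hom o (β.aut o t) = (Γ o).conjStarAlgEquiv (rep.hom o t)

namespace GradedRepresentation

variable {K : Type u} [PartialOrder K] {𝒜 : CStarNet.{u, u} K} {β : 𝒜.Grading}

/-- `π_o(t)` as an operator on `ℋ_o`. -/
def op (R : GradedRepresentation 𝒜 β) (o : K) (t : 𝒜.fiber o) :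
    R.bundle.fiber o →L[ℂ] R.bundle.fiber o :=
  R.rep.hom o t

/-- The holonomy representation: the lift `π_*` of `π` to `𝒜̄_a`, the unitaries `U_*` and the
grading `Γ_a`, on the Hilbert space `ℋ_a`, together with a given operator `F` on `ℋ_a`. -/
def datum (R : GradedRepresentation 𝒜 β) (a : K)
    (F : R.bundle.fiber a →L[ℂ] R.bundle.fiber a) :
    KasparovDatum.{u, u + 1, u} (𝒜.envelope.fiber a) (PosetPi1 a) where
  H := R.bundle.fiber a
  η := 𝒜.lift R.rep a
  V := R.bundle.holonomy a
  Γ := R.Γ a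
  φ := F

end GradedRepresentation

/-- An even (`i = 0`) or odd (`i = 1`) Fredholm module `(π, U, F)` over the net. -/
structure FredholmModule {K : Type u} [PartialOrder K] (𝒜 : CStarNet.{u, u} K) (β : 𝒜.Grading)
    (i : Fin 2) extends GradedRepresentation 𝒜 β where
  F : ∀ o, bundle.fiber o →L[ℂ] bundle.fiber o
  even : i = 0 → ∀ o, (Γ o).conjStarAlgEquiv (F o) = -F o
  odd : i = 1 → ∀ (o : K) (x : bundle.fiber o), Γ o x = x
  selfAdjoint : ∀ o, star (F o) = F o
  parallel : ∀ {o o' : K} (h : o ≤ o') (x : bundle.fiber o),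
    bundle.U h (F o x) = F o' (bundle.U h x)
  compact_sq : ∀ o, IsCompactOp (F o * F o - 1)
  compact_comm : ∀ (o : K) (t : 𝒜.fiber o),
    IsCompactOp (F o * toGradedRepresentation.op o t -
      toGradedRepresentation.op o (β.aut o t) * F o)

/-- An even/odd Fredholm module over the net, localized in `a ∈ K`. -/
structure LocalizedFredholmModule {K : Type u} [PartialOrder K] (𝒜 : CStarNet.{u, u} K)
    (β : 𝒜.Grading) (i : Fin 2) (a : K) extends GradedRepresentation 𝒜 β where
  F : bundle.fiber a →L[ℂ] bundle.fiber a
  even : i = 0 → (Γ a).conjStarAlgEquiv F = -F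
  odd : i = 1 → ∀ (o : K) (x : bundle.fiber o), Γ o x = x
  selfAdjoint : star F = F
  compact_sq : IsCompactOp (F * F - 1)
  compact_comm : ∀ (o : K) (p : PosetPath o a) (t : 𝒜.fiber o),
    IsCompactOp (F * (bundle.along p).conjStarAlgEquiv (toGradedRepresentation.op o t) -
      (bundle.along p).conjStarAlgEquiv (toGradedRepresentation.op o (β.aut o t)) * F)
  compact_equivariant : ∀ q : PosetPath a a,
    IsCompactOp ((bundle.along q).conjStarAlgEquiv F - F)

section Fredholm

variable {K : Type u} [PartialOrder K] {𝒜 : CStarNet.{u, u} K} {β : 𝒜.Grading} {i : Fin 2} {a : K}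

/-- The datum `(π_*, U_*, Γ_a, F_a)` defined by a localized Fredholm module. -/
def LocalizedFredholmModule.datum (M : LocalizedFredholmModule 𝒜 β i a) :
    KasparovDatum.{u, u + 1, u} (𝒜.envelope.fiber a) (PosetPi1 a) :=
  M.toGradedRepresentation.datum a M.F

/-- The datum `(π_*, U_*, Γ_a, F_a)` defined by a Fredholm module and a base point. -/
def FredholmModule.datum (M : FredholmModule 𝒜 β i) (a : K) :
    KasparovDatum.{u, u + 1, u} (𝒜.envelope.fiber a) (PosetPi1 a) :=
  M.toGradedRepresentation.datum a (M.F a)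

/-- A unitary equivalence of graded representations: a family of unitaries intertwining
the inclusion maps, the gradings and the representations. -/
structure GradedRepresentation.Equivalence (R R' : GradedRepresentation 𝒜 β) where
  W : ∀ o, R.bundle.fiber o ≃ₗᵢ[ℂ] R'.bundle.fiber o
  W_U : ∀ {o o' : K} (h : o ≤ o') (x : R.bundle.fiber o),
    W o' (R.bundle.U h x) = R'.bundle.U h (W o x)
  W_Γ : ∀ (o : K) (x : R.bundle.fiber o), W o (R.Γ o x) = R'.Γ o (W o x)
  W_op : ∀ (o : K) (t : 𝒜.fiber o) (x : R.bundle.fiber o),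
    W o (R.op o t x) = R'.op o t (W o x)

/-- Unitary equivalence of localized Fredholm modules. -/
def LocalizedFredholmModule.UnitarilyEquiv (M M' : LocalizedFredholmModule 𝒜 β i a) : Prop :=
  ∃ e : GradedRepresentation.Equivalence M.toGradedRepresentation M'.toGradedRepresentation,
    ∀ x, e.W a (M.F x) = M'.F (e.W a x)

/-- Unitary equivalence of Fredholm modules. -/
def FredholmModule.UnitarilyEquiv (M M' : FredholmModule 𝒜 β i) : Prop :=
  ∃ e : GradedRepresentation.Equivalence M.toGradedRepresentation M'.toGradedRepresentation,
    ∀ (o : K) (x : M.bundle.fiber o), e.W o (M.F o x) = M'.F o (e.W o x)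

end Fredholm

end

/-!
Everything rests on two descriptions of the C*-algebra `A = 𝒜̄_a`. It is generated by the elements
`ȷ̄_p (ε_o t)`, so that *-morphisms on `A` and closed properties stable under the operations need to
be checked on them only (`CStarNet.envelope_hom_ext`, `CStarNet.envelope_induction`); and it is
unital, since the elements `ȷ̄_p (ε_o 1)` all coincide (`CStarNet.isUnitElement_canonicalMor_one`).

*From modules to cycles.* The lift `π_*` sends `ȷ̄_p (ε_o t)` to `ad U_p (π_o t)`; hence covariance,
grading and compactness of the graded commutators pass from the net to `A`
(`LocalizedFredholmModule.isCycle_datum`). A Fredholm module is parallel, so localizing it in `a`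
gives an invariant operator.

*From cycles to modules.* For a choice of paths `a → o`, every path `o → o'` becomes a loop over `a`.
The Hilbert net bundle with constant fibre `H` and transport `V` of these loops carries the
representation `π_o = η ∘ ȷ̄_p ∘ ε_o`, `p : o → a`, whose holonomy representation is the given one
(`KasparovDatum.IsCycle.gradedRepresentation`). The operator of the cycle is then a localized
Fredholm operator exactly if the three compactness and symmetry conditions hold without the factor
`η(t)`. The same transport extends a unitary equivalence over `a` to all fibres
(`GradedRepresentation.exists_equivalence`).

*Every class is represented.* As `A` is unital, `P = η(1)` is a projection which commutes with `V`
and `Γ`, and modulo compact operators `φ P`, `P φ` and `φ' = P (φ + φ*)/2 P` agree. So `φ'`,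
restricted to `P H`, is a cycle which satisfies these conditions
(`KasparovDatum.IsCycle.compression`). It is homotopic to the given one through the Hilbert
`C([0,1])`-module of continuous paths in `H` which end in `P H`, with a path of operators from `φ`
to `φ'` (`KasparovDatum.IsCycle.compressionFamily`). If `φ` is invariant, so is the homotopy.
-/

noncomputable section

/-! ### Compact operators on Hilbert spaces -/

section CompactOperators

variable {H H' : Type*} [NormedAddCommGroup H] [InnerProductSpace ℂ H]
  [NormedAddCommGroup H'] [InnerProductSpace ℂ H']

theorem IsCompactOp.mul_left {T : H →L[ℂ] H} (hT : IsCompactOp T) (S : H →L[ℂ] H) :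
    IsCompactOp (S * T) :=
  hT.clm_comp S

theorem IsCompactOp.mul_right {T : H →L[ℂ] H} (hT : IsCompactOp T) (S : H →L[ℂ] H) :
    IsCompactOp (T * S) :=
  hT.comp_clm S

theorem IsCompactOp.of_eq_add {S T R : H →L[ℂ] H} (h : S = T + R) (hT : IsCompactOp T)
    (hR : IsCompactOp R) : IsCompactOp S := by
  subst h
  exact hT.add hR

theorem IsCompactOp.conj [CompleteSpace H] [CompleteSpace H'] {T : H →L[ℂ] H}
    (hT : IsCompactOp T) (W : H ≃ₗᵢ[ℂ] H') : IsCompactOp (W.conjStarAlgEquiv T) :=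
  (hT.comp_clm (W.symm : H' →L[ℂ] H)).clm_comp (W : H →L[ℂ] H')

/-- A compact operator on a Hilbert space is a norm limit of finite rank operators: compose it with
the projections onto the spans of finite nets of the image of the unit ball. -/
theorem IsCompactOp.mem_closure_span_rankOne [CompleteSpace H] {T : H →L[ℂ] H} (hT : IsCompactOp T) :
    T ∈ closure (Submodule.span ℂ {S : H →L[ℂ] H | ∃ x y : H,
      S = InnerProductSpace.rankOne ℂ x y} : Set (H →L[ℂ] H)) := by
  rw [Metric.mem_closure_iff]
  intro ε hε
  obtain ⟨C, hC, hTC⟩ := IsCompactOperator.image_ball_subset_compact (f := (T : H →ₗ[ℂ] H)) hT 2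
  obtain ⟨t, ht, htC⟩ := Metric.totallyBounded_iff.1 hC.totallyBounded (ε / 2) (by positivity)
  let S : Submodule ℂ H := Submodule.span ℂ t
  have : FiniteDimensional ℂ S := FiniteDimensional.span_of_finite ℂ ht
  have hS : S.starProjection * T ∈ Submodule.span ℂ {S : H →L[ℂ] H | ∃ x y : H,
      S = InnerProductSpace.rankOne ℂ x y} := by
    rw [OrthonormalBasis.starProjection_eq_sum_rankOne (stdOrthonormalBasis ℂ S), Finset.sum_mul]
    refine Submodule.sum_mem _ fun i _ => Submodule.subset_span
      ⟨_, _, InnerProductSpace.rankOne_comp _ _ T⟩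
  refine ⟨_, hS, ?_⟩
  rw [dist_eq_norm]
  refine lt_of_le_of_lt (ContinuousLinearMap.opNorm_le_of_unit_norm (C := ε / 2)
    (by positivity) fun x hx => ?_) (half_lt_self hε)
  have hx' : T x ∈ C := hTC ⟨x, by simp [hx], rfl⟩
  obtain ⟨y, hy, hyx⟩ := Set.mem_iUnion₂.1 (htC hx')
  have h1 : ‖T x - S.starProjection (T x)‖ ≤ ‖T x - y‖ := by
    rw [Submodule.starProjection_minimal]
    exact ciInf_le ⟨0, by rintro _ ⟨z, rfl⟩; exact norm_nonneg _⟩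
      (⟨y, Submodule.subset_span hy⟩ : S)
  refine h1.trans ?_
  rw [← dist_eq_norm]
  exact (Metric.mem_ball.1 hyx).le

/-- Schauder's theorem for Hilbert spaces. -/
theorem IsCompactOp.star [CompleteSpace H] {T : H →L[ℂ] H} (hT : IsCompactOp T) : IsCompactOp (star T) := by
  have hclosed : IsClosed {S : H →L[ℂ] H | IsCompactOp (Star.star S)} :=
    (isClosed_setOfPred_isCompactOperator (𝕜₁ := ℂ) (𝕜₂ := ℂ) (σ₁₂ := RingHom.id ℂ)
      (M₁ := H) (M₂ := H)).preimage continuous_star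
  refine closure_minimal (t := {S : H →L[ℂ] H | IsCompactOp (Star.star S)}) ?_ hclosed
    hT.mem_closure_span_rankOne
  intro S hS
  induction hS using Submodule.span_induction with
  | mem S hS =>
    obtain ⟨x, y, rfl⟩ := hS
    have h : Star.star (InnerProductSpace.rankOne ℂ x y : H →L[ℂ] H) =
      InnerProductSpace.rankOne ℂ y x := InnerProductSpace.adjoint_rankOne x y
    change IsCompactOp _
    rw [h, InnerProductSpace.rankOne_def']
    exact (isCompactOperator_of_locallyCompactSpace_rng
      (ContinuousLinearMap.toSpanSingleton ℂ y)).comp_clm (innerSL ℂ x)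
  | zero =>
    change IsCompactOp _
    rw [star_zero]
    exact isCompactOperator_zero
  | add S S' _ _ h h' =>
    change IsCompactOp _ at h h' ⊢
    rw [star_add]
    exact IsCompactOperator.add h h'
  | smul c S _ h =>
    change IsCompactOp _ at h ⊢
    rw [star_smul]
    exact IsCompactOperator.smul h _

end CompactOperators

/-! ### Hilbert modules of paths with constrained end point -/

section EndpointModule

variable {H : Type u} [NormedAddCommGroup H] [InnerProductSpace ℂ H] {P : H →L[ℂ] H}

/-- The continuous paths `f : [0,1] → H` whose end point `f 1` is fixed by `P`. -/
def constrainedPaths (P : H →L[ℂ] H) : Submodule ℂ C(unitInterval, H) where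
  carrier := {f | P (f 1) = f 1}
  add_mem' {f g} hf hg := by
    change P (f 1 + g 1) = f 1 + g 1
    rw [map_add, hf, hg]
  zero_mem' := map_zero P
  smul_mem' c f hf := by
    change P (c • f 1) = c • f 1
    rw [map_smul, hf]

/-- The space of continuous paths in `H` whose end point is fixed by `P`, with the supremum norm.
For a projection `P` this is a Hilbert `C([0,1])`-module with fibre `H` over `s < 1` and `P H`
over `1`. It is not an `abbrev`, so that its topology is that of the norm. -/
def EndpointModule (P : H →L[ℂ] H) : Type u := constrainedPaths P

namespace EndpointModule

instance : NormedAddCommGroup (EndpointModule P) :=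
  inferInstanceAs (NormedAddCommGroup (constrainedPaths P))

instance : NormedSpace ℂ (EndpointModule P) :=
  inferInstanceAs (NormedSpace ℂ (constrainedPaths P))

instance [CompleteSpace H] : CompleteSpace (EndpointModule P) := by
  have h : IsClosed (constrainedPaths P : Set C(unitInterval, H)) :=
    isClosed_eq (P.continuous.comp (continuous_eval_const 1)) (continuous_eval_const 1)
  exact h.completeSpace_coe

instance : FunLike (EndpointModule P) unitInterval H where
  coe f := (f : constrainedPaths P).1
  coe_injective _ _ h := Subtype.ext (DFunLike.coe_injective h)

/-- The element given by a continuous path. -/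
def mk (f : unitInterval → H) (hf : Continuous f) (h : P (f 1) = f 1) : EndpointModule P :=
  (⟨⟨f, hf⟩, h⟩ : constrainedPaths P)

@[simp] theorem mk_apply (f : unitInterval → H) (hf : Continuous f) (h : P (f 1) = f 1)
    (s : unitInterval) : mk f hf h s = f s := rfl

@[ext] theorem ext {f g : EndpointModule P} (h : ∀ s, f s = g s) : f = g := DFunLike.ext f g h

@[fun_prop] theorem continuous (f : EndpointModule P) : Continuous fun s => f s :=
  ContinuousMap.continuous (f : constrainedPaths P).1

theorem apply_one (f : EndpointModule P) : P (f 1) = f 1 := Subtype.property f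

@[simp] theorem add_apply (f g : EndpointModule P) (s : unitInterval) : (f + g) s = f s + g s := rfl

@[simp] theorem sub_apply (f g : EndpointModule P) (s : unitInterval) : (f - g) s = f s - g s := rfl

@[simp] theorem smul_apply (z : ℂ) (f : EndpointModule P) (s : unitInterval) :
    (z • f) s = z • f s := rfl

theorem norm_apply_le (f : EndpointModule P) (s : unitInterval) : ‖f s‖ ≤ ‖f‖ :=
  ContinuousMap.norm_coe_le_norm (f : constrainedPaths P).1 s

theorem norm_le {f : EndpointModule P} {C : ℝ} (hC : 0 ≤ C) (h : ∀ s, ‖f s‖ ≤ C) : ‖f‖ ≤ C :=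
  (ContinuousMap.norm_le (f : constrainedPaths P).1 hC).2 h

instance : SMul C(unitInterval, ℂ) (EndpointModule P) where
  smul c f := mk (fun s => c s • f s) (by fun_prop) (by rw [map_smul, f.apply_one])

/-- The `C([0,1])`-valued inner product is the pointwise one. -/
instance : CStarModule C(unitInterval, ℂ) (EndpointModule P) where
  inner f g := ⟨fun s => inner ℂ (f s) (g s), by fun_prop⟩
  inner_add_right := by
    intros; ext s; exact inner_add_right _ _ _
  inner_self_nonneg := by
    intro f s
    change 0 ≤ inner ℂ (f s) (f s)
    rw [inner_self_eq_norm_sq_to_K]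
    rw [← RCLike.ofReal_pow]
    exact Complex.zero_le_real.2 (sq_nonneg ‖f s‖)
  inner_self := by
    intro f
    refine ⟨fun h => ?_, fun h => ?_⟩
    · ext s
      exact inner_self_eq_zero.1 (DFunLike.congr_fun h s)
    · subst h
      ext s
      exact inner_zero_left _
  inner_op_smul_right := by
    intros; ext s; exact inner_smul_right _ _ _
  inner_smul_right_complex := by
    intros; ext s; exact inner_smul_right _ _ _
  star_inner f g := by
    ext s; exact inner_conj_symm _ _
  norm_eq_sqrt_norm_inner_self f := by
    refine le_antisymm (norm_le (Real.sqrt_nonneg _) fun s => Real.le_sqrt_of_sq_le ?_)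
      (Real.sqrt_le_iff.2 ⟨norm_nonneg _,
        (ContinuousMap.norm_le _ (by positivity)).2 fun s => ?_⟩)
    · refine le_trans ?_ (ContinuousMap.norm_coe_le_norm _ s)
      change ‖f s‖ ^ 2 ≤ ‖inner ℂ (f s) (f s)‖
      rw [inner_self_eq_norm_sq_to_K]
      simp
    · change ‖inner ℂ (f s) (f s)‖ ≤ _
      refine (norm_inner_le_norm _ _).trans ?_
      rw [sq]
      exact mul_le_mul (norm_apply_le f s) (norm_apply_le f s) (norm_nonneg _) (norm_nonneg _)

theorem inner_apply (f g : EndpointModule P) (s : unitInterval) :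
    (inner C(unitInterval, ℂ) f g : C(unitInterval, ℂ)) s = inner ℂ (f s) (g s) := rfl

/-- The operator `f ↦ (s ↦ c(s) T f(s))`, for a scalar function `c` and an operator `T`. It
preserves the condition at the end point if `T` maps the fixed points of `P` to fixed points of `P`,
or if `c(1) = 0`. -/
def fieldOp (c : C(unitInterval, ℂ)) (T : H →L[ℂ] H)
    (h : ∀ x, P x = x → c 1 • P (T x) = c 1 • T x) : EndpointModule P →L[ℂ] EndpointModule P :=
  LinearMap.mkContinuous
    { toFun := fun f => mk (fun s => c s • T (f s)) (by fun_prop)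
        (by rw [map_smul, h _ f.apply_one])
      map_add' := fun f g => by ext s; simp
      map_smul' := fun z f => by ext s; simp [smul_comm (c s) z] }
    (‖c‖ * ‖T‖) fun f => norm_le (by positivity) fun s => by
      change ‖c s • T (f s)‖ ≤ _
      rw [norm_smul, mul_assoc]
      exact mul_le_mul (ContinuousMap.norm_coe_le_norm c s)
        ((T.le_opNorm _).trans (mul_le_mul_of_nonneg_left (norm_apply_le f s) (norm_nonneg _)))
        (norm_nonneg _) (norm_nonneg _)

@[simp] theorem fieldOp_apply (c : C(unitInterval, ℂ)) (T : H →L[ℂ] H)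
    (h : ∀ x, P x = x → c 1 • P (T x) = c 1 • T x) (f : EndpointModule P) (s : unitInterval) :
    fieldOp c T h f s = c s • T (f s) := rfl

theorem norm_fieldOp_le (c : C(unitInterval, ℂ)) (T : H →L[ℂ] H)
    (h : ∀ x, P x = x → c 1 • P (T x) = c 1 • T x) : ‖fieldOp c T h‖ ≤ ‖c‖ * ‖T‖ :=
  LinearMap.mkContinuous_norm_le _ (by positivity) _

theorem inner_fieldOp_left [CompleteSpace H] {c : C(unitInterval, ℂ)} (hc : star c = c)
    {T T' : H →L[ℂ] H} (hT : star T = T') (h : ∀ x, P x = x → c 1 • P (T x) = c 1 • T x)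
    (h' : ∀ x, P x = x → c 1 • P (T' x) = c 1 • T' x) (f g : EndpointModule P) :
    inner C(unitInterval, ℂ) (fieldOp c T h f) g =
      inner C(unitInterval, ℂ) f (fieldOp c T' h' g) := by
  subst hT
  refine ContinuousMap.ext fun s => ?_
  have hs : (starRingEnd ℂ) (c s) = c s := DFunLike.congr_fun hc s
  rw [inner_apply, inner_apply, fieldOp_apply, fieldOp_apply, inner_smul_left, inner_smul_right, hs]
  exact congrArg (c s * ·) (ContinuousLinearMap.adjoint_inner_right T (f s) (g s)).symm

/-- If `K` is compact with `Q K = K = K R*`, and `b Q` and `b' R` map into the paths which satisfy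
the condition at the end point, then `b b'^* K` is a compact operator of the module: the finite rank
approximations of `K` yield the generators `z ↦ b Q x ⟨b' R y, z⟩`. -/
theorem fieldOp_mem_compact [CompleteSpace H] {c b b' : C(unitInterval, ℂ)} (hc : c = b * star b')
    {K Q R : H →L[ℂ] H} (hK : IsCompactOp K) (hQK : Q * K = K) (hKR : K * star R = K)
    (hQ : ∀ x, b 1 • P (Q x) = b 1 • Q x) (hR : ∀ x, b' 1 • P (R x) = b' 1 • R x)
    (h : ∀ x, P x = x → c 1 • P (K x) = c 1 • K x) :
    fieldOp c K h ∈ compactModuleOperators C(unitInterval, ℂ) (EndpointModule P) := by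
  have hcQ : ∀ x, c 1 • P (Q x) = c 1 • Q x := fun x => by
    rw [hc, mul_comm, ContinuousMap.mul_apply, mul_smul, mul_smul, hQ]
  let L : (H →L[ℂ] H) →ₗ[ℂ] (EndpointModule P →L[ℂ] EndpointModule P) :=
    { toFun := fun S => fieldOp c (Q * S * star R) fun x _ => hcQ (S (star R x))
      map_add' := fun S T => by
        ext f s
        change c s • Q ((S + T) (star R (f s))) =
          c s • Q (S (star R (f s))) + c s • Q (T (star R (f s)))
        rw [_root_.add_apply, map_add, smul_add]
      map_smul' := fun z S => by
        ext f s
        change c s • Q ((z • S) (star R (f s))) = z • c s • Q (S (star R (f s)))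
        rw [_root_.smul_apply, map_smul, smul_comm] }
  have hLc : Continuous L :=
    AddMonoidHomClass.continuous_of_bound L (‖c‖ * ‖Q‖ * ‖star R‖) fun S => by
      refine (norm_fieldOp_le _ _ fun x _ => hcQ (S (star R x))).trans ?_
      have := (norm_mul_le (Q * S) (star R)).trans
        (mul_le_mul_of_nonneg_right (norm_mul_le Q S) (norm_nonneg (star R)))
      calc ‖c‖ * ‖Q * S * star R‖ ≤ ‖c‖ * (‖Q‖ * ‖S‖ * ‖star R‖) :=
            mul_le_mul_of_nonneg_left this (norm_nonneg _)
        _ = _ := by ring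
  have hLK : L K = fieldOp c K h := by
    ext f s
    change c s • (Q * K * star R) (f s) = c s • K (f s)
    rw [hQK, hKR]
  rw [← hLK]
  refine map_mem_closure hLc hK.mem_closure_span_rankOne fun S hS => ?_
  induction hS using Submodule.span_induction with
  | mem S hS =>
    obtain ⟨x, y, rfl⟩ := hS
    refine Submodule.subset_span ⟨mk (fun s => b s • Q x) (by fun_prop) ?_,
      mk (fun s => b' s • R y) (by fun_prop) ?_, fun f => ?_⟩
    · rw [map_smul, hQ]
    · rw [map_smul, hR]
    · ext s
      have hadj : inner ℂ (R y) (f s) = inner ℂ y (star R (f s)) :=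
        (ContinuousLinearMap.adjoint_inner_right R y (f s)).symm
      change c s • Q (inner ℂ y (star R (f s)) • x) = inner ℂ (b' s • R y) (f s) • b s • Q x
      rw [inner_smul_left, hadj, map_smul, smul_smul, smul_smul, hc]
      congr 1
      change b s * star (b' s) * _ = star (b' s) * _ * b s
      ring
  | zero => rw [map_zero]; exact Submodule.zero_mem _
  | add S T _ _ hS hT => rw [map_add]; exact Submodule.add_mem _ hS hT
  | smul z S _ hS => rw [map_smul]; exact Submodule.smul_mem _ z hS

/-- A compact operator times a function which vanishes at the end point. -/
theorem fieldOp_mem_compact_of_vanishing [CompleteSpace H] {c b b' : C(unitInterval, ℂ)}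
    (hc : c = b * star b') (hb : b 1 = 0) (hb' : b' 1 = 0) {K : H →L[ℂ] H} (hK : IsCompactOp K)
    (h : ∀ x, P x = x → c 1 • P (K x) = c 1 • K x) :
    fieldOp c K h ∈ compactModuleOperators C(unitInterval, ℂ) (EndpointModule P) :=
  fieldOp_mem_compact (Q := 1) (R := 1) hc hK (one_mul K) (by rw [star_one, mul_one])
    (fun x => by rw [hb, zero_smul, zero_smul]) (fun x => by rw [hb', zero_smul, zero_smul]) h

/-- A function times a compact operator which lives on the range of the projection `P`. -/
theorem fieldOp_mem_compact_of_compressed [CompleteSpace H] (hP : star P = P) (hPP : P * P = P)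
    (c : C(unitInterval, ℂ)) {K : H →L[ℂ] H} (hK : IsCompactOp K) (hPK : P * K = K)
    (hKP : K * P = K) (h : ∀ x, P x = x → c 1 • P (K x) = c 1 • K x) :
    fieldOp c K h ∈ compactModuleOperators C(unitInterval, ℂ) (EndpointModule P) := by
  have hPx : ∀ x, P (P x) = P x := fun x => DFunLike.congr_fun hPP x
  exact fieldOp_mem_compact (b := c) (b' := 1) (Q := P) (R := P) (by rw [star_one, mul_one]) hK hPK
    (by rw [hP, hKP]) (fun x => by rw [hPx]) (fun x => by rw [hPx]) h

/-- A unitary commuting with `P` acts pointwise. -/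
def mapUnitary (W : H ≃ₗᵢ[ℂ] H) (hW : ∀ x, P (W x) = W (P x)) :
    EndpointModule P ≃ₗᵢ[ℂ] EndpointModule P where
  toFun f := mk (fun s => W (f s)) (by fun_prop) (by rw [hW, f.apply_one])
  invFun f := mk (fun s => W.symm (f s)) (by fun_prop) (by
    apply W.injective
    rw [← hW, W.apply_symm_apply, f.apply_one])
  left_inv f := by ext s; exact W.symm_apply_apply _
  right_inv f := by ext s; exact W.apply_symm_apply _
  map_add' f g := by ext s; exact map_add W _ _
  map_smul' z f := by ext s; exact map_smul W _ _
  norm_map' f := le_antisymm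
    (norm_le (norm_nonneg _) fun s => (W.norm_map (f s)).trans_le (norm_apply_le f s))
    (norm_le (norm_nonneg _) fun s => (W.norm_map (f s)).symm.trans_le
      (norm_apply_le (mk (P := P) (fun s => W (f s)) (by fun_prop)
        (by rw [hW, f.apply_one])) s))

@[simp] theorem mapUnitary_apply (W : H ≃ₗᵢ[ℂ] H) (hW : ∀ x, P (W x) = W (P x))
    (f : EndpointModule P) (s : unitInterval) : mapUnitary W hW f s = W (f s) := rfl

end EndpointModule

end EndpointModule

/-! ### Compression of operators to the fixed space of a projection -/

section FixedSpace

variable {H : Type u} [NormedAddCommGroup H] [InnerProductSpace ℂ H]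

/-- The space of fixed points of `P`; the range of `P` if `P` is a projection. -/
def fixedSpace (P : H →L[ℂ] H) : Submodule ℂ H where
  carrier := {x | P x = x}
  add_mem' {x y} hx hy := by
    change P (x + y) = x + y
    rw [map_add, hx, hy]
  zero_mem' := map_zero P
  smul_mem' c x hx := by
    change P (c • x) = c • x
    rw [map_smul, hx]

namespace fixedSpace

variable {P : H →L[ℂ] H}

theorem isClosed : IsClosed (fixedSpace P : Set H) := isClosed_eq P.continuous continuous_id

instance [CompleteSpace H] : CompleteSpace (fixedSpace P) := isClosed.completeSpace_coe

/-- The restriction to the fixed points of `P` of an operator which preserves them. -/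
def restrictOp (T : H →L[ℂ] H) (h : ∀ x, P x = x → P (T x) = T x) :
    fixedSpace P →L[ℂ] fixedSpace P :=
  (T ∘L (fixedSpace P).subtypeL).codRestrict (fixedSpace P) fun x => h x x.2

theorem restrictOp_compact {T : H →L[ℂ] H} (h : ∀ x, P x = x → P (T x) = T x)
    (hT : IsCompactOp T) : IsCompactOp (restrictOp T h) :=
  (hT.comp_clm (fixedSpace P).subtypeL).codRestrict (fun x => h x x.2) isClosed

theorem star_restrictOp [CompleteSpace H] (T : H →L[ℂ] H) (h : ∀ x, P x = x → P (T x) = T x)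
    (h' : ∀ x, P x = x → P (star T x) = star T x) :
    star (restrictOp T h) = restrictOp (star T) h' := by
  refine ((ContinuousLinearMap.eq_adjoint_iff _ _).2 fun x y => ?_).symm
  exact ContinuousLinearMap.adjoint_inner_left T (y : H) (x : H)

/-- The restriction to the fixed points of `P` of a unitary which commutes with `P`. -/
def restrictUnitary (W : H ≃ₗᵢ[ℂ] H) (hW : ∀ x, P (W x) = W (P x)) :
    fixedSpace P ≃ₗᵢ[ℂ] fixedSpace P where
  toFun x := ⟨W x, by change P (W x) = W x; rw [hW, show P x = x from x.2]⟩
  invFun x := ⟨W.symm x, by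
    change P (W.symm x) = W.symm x
    apply W.injective
    rw [← hW, W.apply_symm_apply, show P x = x from x.2]⟩
  left_inv x := Subtype.ext (W.symm_apply_apply _)
  right_inv x := Subtype.ext (W.apply_symm_apply _)
  map_add' x y := Subtype.ext (map_add W _ _)
  map_smul' z x := Subtype.ext (map_smul W _ _)
  norm_map' x := W.norm_map _

end fixedSpace

end FixedSpace

/-! ### Normalization of a cycle -/

/-- `e` is a unit element of the algebra `A`, whose type carries no unital structure. -/
def IsUnitElement {A : Type*} [Mul A] (e : A) : Prop := ∀ t : A, e * t = t ∧ t * e = t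

section IsUnitElement

variable {A : Type*} [NonUnitalCStarAlgebra A] {e : A}

theorem IsUnitElement.star_eq (he : IsUnitElement e) : star e = e := by
  have h := (he (star e)).2
  have h' := congrArg star h
  rw [star_mul, star_star] at h'
  exact h.symm.trans h'

theorem IsUnitElement.map_eq (he : IsUnitElement e) (σ : A ≃⋆ₐ[ℂ] A) : σ e = e := by
  have h := congrArg σ (he (σ.symm e)).1
  rwa [map_mul, σ.apply_symm_apply, (he _).2] at h

end IsUnitElement

namespace KasparovDatum

variable {A : Type w} [NonUnitalCStarAlgebra A] {G : Type v} [Group G]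
  {d : KasparovDatum.{u, w, v} A G} {α : G →* (A ≃⋆ₐ[ℂ] A)} {γ : A ≃⋆ₐ[ℂ] A} {i : Fin 2} {e : A}

section Projection

theorem star_η_unit (he : IsUnitElement e) : star (d.η e) = d.η e := by
  rw [← map_star, he.star_eq]

theorem η_unit_mul (he : IsUnitElement e) (t : A) : d.η e * d.η t = d.η t := by
  rw [← map_mul, (he t).1]

theorem mul_η_unit (he : IsUnitElement e) (t : A) : d.η t * d.η e = d.η t := by
  rw [← map_mul, (he t).2]

theorem IsCycle.conj_V_η_unit (hd : d.IsCycle α γ i) (he : IsUnitElement e) (g : G) :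
    (d.V g).conjStarAlgEquiv (d.η e) = d.η e := by
  rw [← hd.covariant, he.map_eq]

theorem IsCycle.conj_Γ_η_unit (hd : d.IsCycle α γ i) (he : IsUnitElement e) :
    d.Γ.conjStarAlgEquiv (d.η e) = d.η e := by
  rw [← hd.graded, he.map_eq]

theorem IsCycle.η_unit_V (hd : d.IsCycle α γ i) (he : IsUnitElement e) (g : G) (x : d.H) :
    d.η e (d.V g x) = d.V g (d.η e x) := by
  conv_lhs => rw [← hd.conj_V_η_unit he g]
  rw [LinearIsometryEquiv.conjStarAlgEquiv_apply_apply, LinearIsometryEquiv.symm_apply_apply]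

theorem IsCycle.η_unit_Γ (hd : d.IsCycle α γ i) (he : IsUnitElement e) (x : d.H) :
    d.η e (d.Γ x) = d.Γ (d.η e x) := by
  conv_lhs => rw [← hd.conj_Γ_η_unit he]
  rw [LinearIsometryEquiv.conjStarAlgEquiv_apply_apply, LinearIsometryEquiv.symm_apply_apply]

end Projection

section NormalizedOp

variable (d e) in
/-- The compression `P (φ + φ*)/2 P` of the real part of `φ`, where `P = η(e)`. -/
def normalizedOp : d.H →L[ℂ] d.H := d.η e * ((2⁻¹ : ℂ) • (d.φ + star d.φ)) * d.η e

theorem star_normalizedOp (he : IsUnitElement e) : star (d.normalizedOp e) = d.normalizedOp e := by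
  rw [normalizedOp, star_mul, star_mul, star_smul, star_add, star_star, star_η_unit he, mul_assoc,
    add_comm, Complex.star_def, map_inv₀, map_ofNat]

theorem η_unit_mul_normalizedOp (he : IsUnitElement e) :
    d.η e * d.normalizedOp e = d.normalizedOp e := by
  rw [normalizedOp, ← mul_assoc, ← mul_assoc, η_unit_mul he]

theorem normalizedOp_mul_η_unit (he : IsUnitElement e) :
    d.normalizedOp e * d.η e = d.normalizedOp e := by
  rw [normalizedOp, mul_assoc, η_unit_mul he]

theorem IsCycle.compact_comm_unit (hd : d.IsCycle α γ i) (he : IsUnitElement e) :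
    IsCompactOp (d.φ * d.η e - d.η e * d.φ) := by
  have h := hd.compact_comm e
  rwa [he.map_eq] at h

/-- The normalized operator is a compact perturbation of `φ P`. -/
theorem IsCycle.compact_normalizedOp_sub (hd : d.IsCycle α γ i) (he : IsUnitElement e) :
    IsCompactOp (d.normalizedOp e - d.φ * d.η e) := by
  have hPP := η_unit_mul (d := d) he e
  refine IsCompactOp.of_eq_add (T := (-(2⁻¹ : ℂ) • d.η e) * ((d.φ - star d.φ) * d.η e))
    (R := (d.φ * d.η e - d.η e * d.φ) * -d.η e) ?_
    ((hd.compact_selfAdjoint e).mul_left _) ((hd.compact_comm_unit he).mul_right _)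
  rw [normalizedOp, sub_mul (d.φ * d.η e), mul_neg, mul_assoc d.φ, hPP]
  simp only [mul_add, add_mul, sub_mul, mul_sub, mul_smul_comm, smul_mul_assoc, mul_assoc, mul_neg]
  module

theorem IsCycle.compact_normalizedOp_sub' (hd : d.IsCycle α γ i) (he : IsUnitElement e) :
    IsCompactOp (d.normalizedOp e - d.η e * d.φ) :=
  IsCompactOp.of_eq_add (sub_add_sub_cancel _ _ _).symm (hd.compact_normalizedOp_sub he)
    (hd.compact_comm_unit he)

theorem IsCycle.compact_φ_mul_normalizedOp (hd : d.IsCycle α γ i) (he : IsUnitElement e) :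
    IsCompactOp (d.φ * d.normalizedOp e - d.φ * d.φ * d.η e) := by
  have h := (hd.compact_normalizedOp_sub he).mul_left d.φ
  rwa [mul_sub, ← mul_assoc] at h

theorem IsCycle.compact_normalizedOp_mul_φ (hd : d.IsCycle α γ i) (he : IsUnitElement e) :
    IsCompactOp (d.normalizedOp e * d.φ * d.η e - d.φ * d.φ * d.η e) := by
  have hPP := η_unit_mul (d := d) he e
  refine IsCompactOp.of_eq_add (T := (d.normalizedOp e - d.φ * d.η e) * (d.φ * d.η e))
    (R := d.φ * ((d.φ * d.η e - d.η e * d.φ) * (-d.η e))) ?_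
    ((hd.compact_normalizedOp_sub he).mul_right _)
    (((hd.compact_comm_unit he).mul_right _).mul_left _)
  simp only [sub_mul, mul_sub, mul_neg, mul_assoc, hPP]
  abel

theorem IsCycle.compact_normalizedOp_sq (hd : d.IsCycle α γ i) (he : IsUnitElement e) :
    IsCompactOp ((d.normalizedOp e * d.normalizedOp e - 1) * d.η e) := by
  refine IsCompactOp.of_eq_add
    (T := d.normalizedOp e * (d.normalizedOp e - d.φ * d.η e))
    (R := (d.normalizedOp e * d.φ * d.η e - d.φ * d.φ * d.η e) + (d.φ * d.φ - 1) * d.η e) ?_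
    ((hd.compact_normalizedOp_sub he).mul_left _)
    ((hd.compact_normalizedOp_mul_φ he).add (hd.compact_sq e))
  simp only [sub_mul, mul_sub, mul_assoc, normalizedOp_mul_η_unit he]
  abel

/-- The mixed term in the square of the path `(1 - s)² φ + (1 - (1 - s)²) ψ` from `φ` to
its normalization `ψ`: modulo compacts `φ ψ + ψ φ = 2` on the range of `η(e)`. -/
theorem IsCycle.compact_normalizedOp_mixed (hd : d.IsCycle α γ i) (he : IsUnitElement e) :
    IsCompactOp ((d.φ * d.normalizedOp e + d.normalizedOp e * d.φ - 2) * d.η e) := by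
  refine IsCompactOp.of_eq_add
    (T := (d.φ * d.normalizedOp e - d.φ * d.φ * d.η e) +
      (d.normalizedOp e * d.φ * d.η e - d.φ * d.φ * d.η e))
    (R := (d.φ * d.φ - 1) * d.η e + (d.φ * d.φ - 1) * d.η e) ?_
    ((hd.compact_φ_mul_normalizedOp he).add (hd.compact_normalizedOp_mul_φ he))
    ((hd.compact_sq e).add (hd.compact_sq e))
  simp only [sub_mul, add_mul, mul_assoc, normalizedOp_mul_η_unit he, two_mul, one_mul]
  abel

theorem IsCycle.compact_normalizedOp_comm (hd : d.IsCycle α γ i) (he : IsUnitElement e) (t : A) :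
    IsCompactOp (d.normalizedOp e * d.η t - d.η (γ t) * d.normalizedOp e) := by
  refine IsCompactOp.of_eq_add
    (T := (d.normalizedOp e - d.φ * d.η e) * d.η t +
      d.η (γ t) * -(d.normalizedOp e - d.η e * d.φ))
    (R := d.φ * d.η t - d.η (γ t) * d.φ) ?_
    (((hd.compact_normalizedOp_sub he).mul_right _).add
      (IsCompactOp.mul_left (hd.compact_normalizedOp_sub' he).neg (d.η (γ t)))) (hd.compact_comm t)
  rw [neg_sub, mul_sub, sub_mul, mul_assoc d.φ, η_unit_mul he, ← mul_assoc (d.η (γ t)),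
    mul_η_unit he]
  abel

theorem IsCycle.compact_normalizedOp_equivariant (hd : d.IsCycle α γ i) (he : IsUnitElement e)
    (g : G) :
    IsCompactOp ((d.V g).conjStarAlgEquiv (d.normalizedOp e) - d.normalizedOp e) := by
  refine IsCompactOp.of_eq_add
    (T := (d.V g).conjStarAlgEquiv (d.normalizedOp e - d.φ * d.η e) +
      -(d.normalizedOp e - d.φ * d.η e))
    (R := ((d.V g).conjStarAlgEquiv d.φ - d.φ) * d.η e) ?_
    (((hd.compact_normalizedOp_sub he).conj _).add (hd.compact_normalizedOp_sub he).neg)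
    (hd.compact_equivariant g e)
  rw [map_sub, map_mul, hd.conj_V_η_unit he, sub_mul]
  abel

theorem IsCycle.conj_Γ_normalizedOp (hd : d.IsCycle α γ i) (he : IsUnitElement e) (hi : i = 0) :
    d.Γ.conjStarAlgEquiv (d.normalizedOp e) = -d.normalizedOp e := by
  rw [normalizedOp, map_mul, map_mul, map_smul, map_add, map_star, hd.even hi,
    hd.conj_Γ_η_unit he, star_neg, ← neg_add, smul_neg, mul_neg, neg_mul]

theorem IsCycle.conj_V_normalizedOp (hd : d.IsCycle α γ i) (he : IsUnitElement e)
    (h : d.IsInvariant) (g : G) :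
    (d.V g).conjStarAlgEquiv (d.normalizedOp e) = d.normalizedOp e := by
  rw [normalizedOp, map_mul, map_mul, map_smul, map_add, map_star, h g, hd.conj_V_η_unit he]

end NormalizedOp

end KasparovDatum

namespace KasparovDatum

variable {A : Type w} [NonUnitalCStarAlgebra A] {G : Type v} [Group G]
  {d : KasparovDatum.{u, w, v} A G} {α : G →* (A ≃⋆ₐ[ℂ] A)} {γ : A ≃⋆ₐ[ℂ] A} {i : Fin 2} {e : A}

/-! ### The compressed cycle -/

section Compression

theorem η_preserves (he : IsUnitElement e) (t : A) (x : d.H) (_ : d.η e x = x) :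
    d.η e (d.η t x) = d.η t x :=
  DFunLike.congr_fun (η_unit_mul (d := d) he t) x

theorem normalizedOp_preserves (he : IsUnitElement e) (x : d.H) (_ : d.η e x = x) :
    d.η e (d.normalizedOp e x) = d.normalizedOp e x :=
  DFunLike.congr_fun (η_unit_mul_normalizedOp (d := d) he) x

/-- The restriction of a cycle to the range of the projection `η(e)`, with the normalized
operator. -/
def IsCycle.compression (hd : d.IsCycle α γ i) (he : IsUnitElement e) :
    KasparovDatum.{u, w, v} A G where
  H := fixedSpace (d.η e)
  η :=
    { toFun := fun t => fixedSpace.restrictOp (d.η t) (η_preserves he t)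
      map_smul' := fun c t => by
        ext x
        exact DFunLike.congr_fun (map_smul d.η c t) (x : d.H)
      map_zero' := by
        ext x
        exact DFunLike.congr_fun (map_zero d.η) (x : d.H)
      map_add' := fun s t => by
        ext x
        exact DFunLike.congr_fun (map_add d.η s t) (x : d.H)
      map_mul' := fun s t => by
        ext x
        exact DFunLike.congr_fun (map_mul d.η s t) (x : d.H)
      map_star' := fun t => by
        rw [fixedSpace.star_restrictOp (d.η t) (η_preserves he t)
          (by rw [← map_star]; exact η_preserves he (star t))]
        ext x
        exact DFunLike.congr_fun (map_star d.η t) (x : d.H) }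
  V :=
    { toFun := fun g => fixedSpace.restrictUnitary (d.V g) (hd.η_unit_V he g)
      map_one' := by
        ext x
        exact DFunLike.congr_fun (map_one d.V) (x : d.H)
      map_mul' := fun g h => by
        ext x
        exact DFunLike.congr_fun (map_mul d.V g h) (x : d.H) }
  Γ := fixedSpace.restrictUnitary d.Γ (hd.η_unit_Γ he)
  φ := fixedSpace.restrictOp (d.normalizedOp e) (normalizedOp_preserves he)

theorem IsCycle.star_compression_φ (hd : d.IsCycle α γ i) (he : IsUnitElement e) :
    star (hd.compression he).φ = (hd.compression he).φ := by
  have h := star_normalizedOp (d := d) he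
  refine (fixedSpace.star_restrictOp (d.normalizedOp e) (normalizedOp_preserves he)
    (by rw [h]; exact normalizedOp_preserves he)).trans ?_
  refine ContinuousLinearMap.ext fun x : fixedSpace (d.η e) => Subtype.ext ?_
  exact DFunLike.congr_fun h (x : d.H)

theorem IsCycle.compact_compression_sq (hd : d.IsCycle α γ i) (he : IsUnitElement e) :
    IsCompactOp ((hd.compression he).φ * (hd.compression he).φ - 1) := by
  have h : ∀ x, d.η e x = x →
      d.η e (((d.normalizedOp e * d.normalizedOp e - 1) * d.η e) x) =
        ((d.normalizedOp e * d.normalizedOp e - 1) * d.η e) x := by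
    intro x hx
    change d.η e (d.normalizedOp e (d.normalizedOp e (d.η e x)) - d.η e x) =
      d.normalizedOp e (d.normalizedOp e (d.η e x)) - d.η e x
    rw [map_sub, hx, hx, normalizedOp_preserves he _ (normalizedOp_preserves he _ hx)]
  have key : fixedSpace.restrictOp (d.normalizedOp e) (normalizedOp_preserves he) *
      fixedSpace.restrictOp (d.normalizedOp e) (normalizedOp_preserves he) - 1 =
      fixedSpace.restrictOp _ h := by
    ext x
    change d.normalizedOp e (d.normalizedOp e x) - x =
      d.normalizedOp e (d.normalizedOp e (d.η e x)) - d.η e x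
    rw [show d.η e x = x from x.2]
  have hc := fixedSpace.restrictOp_compact h (hd.compact_normalizedOp_sq he)
  rw [← key] at hc
  exact hc

theorem IsCycle.compact_compression_equivariant (hd : d.IsCycle α γ i) (he : IsUnitElement e)
    (g : G) :
    IsCompactOp (((hd.compression he).V g).conjStarAlgEquiv (hd.compression he).φ -
      (hd.compression he).φ) := by
  have h : ∀ x, d.η e x = x →
      d.η e (((d.V g).conjStarAlgEquiv (d.normalizedOp e) - d.normalizedOp e) x) =
        ((d.V g).conjStarAlgEquiv (d.normalizedOp e) - d.normalizedOp e) x := by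
    intro x hx
    have hx' : d.η e ((d.V g).symm x) = (d.V g).symm x := by
      apply (d.V g).injective
      rw [← hd.η_unit_V he, LinearIsometryEquiv.apply_symm_apply, hx]
    change d.η e (d.V g (d.normalizedOp e ((d.V g).symm x)) - d.normalizedOp e x) =
      d.V g (d.normalizedOp e ((d.V g).symm x)) - d.normalizedOp e x
    rw [map_sub, hd.η_unit_V he, normalizedOp_preserves he _ hx, normalizedOp_preserves he _ hx']
  exact fixedSpace.restrictOp_compact h (hd.compact_normalizedOp_equivariant he g)

theorem IsCycle.isCycle_compression (hd : d.IsCycle α γ i) (he : IsUnitElement e) :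
    (hd.compression he).IsCycle α γ i where
  covariant g t := by
    refine ContinuousLinearMap.ext fun x : fixedSpace (d.η e) => Subtype.ext ?_
    exact DFunLike.congr_fun (hd.covariant g t) (x : d.H)
  grading_sq x := Subtype.ext (hd.grading_sq (x : fixedSpace (d.η e)).1)
  grading_comm g x := Subtype.ext (hd.grading_comm g (x : fixedSpace (d.η e)).1)
  graded t := by
    refine ContinuousLinearMap.ext fun x : fixedSpace (d.η e) => Subtype.ext ?_
    exact DFunLike.congr_fun (hd.graded t) (x : d.H)
  even hi := by
    refine ContinuousLinearMap.ext fun x : fixedSpace (d.η e) => Subtype.ext ?_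
    exact DFunLike.congr_fun (hd.conj_Γ_normalizedOp he hi) (x : d.H)
  odd hi x := Subtype.ext (hd.odd hi (x : fixedSpace (d.η e)).1)
  compact_selfAdjoint t := by
    rw [hd.star_compression_φ he, sub_self, zero_mul]
    exact isCompactOperator_zero
  compact_sq t := (hd.compact_compression_sq he).mul_right _
  compact_comm t := by
    have h : ∀ x, d.η e x = x →
        d.η e ((d.normalizedOp e * d.η t - d.η (γ t) * d.normalizedOp e) x) =
          (d.normalizedOp e * d.η t - d.η (γ t) * d.normalizedOp e) x := by
      intro x hx
      change d.η e (d.normalizedOp e (d.η t x) - d.η (γ t) (d.normalizedOp e x)) =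
        d.normalizedOp e (d.η t x) - d.η (γ t) (d.normalizedOp e x)
      rw [map_sub, normalizedOp_preserves he _ (η_preserves he t x hx),
        η_preserves he _ _ (normalizedOp_preserves he x hx)]
    exact fixedSpace.restrictOp_compact h (hd.compact_normalizedOp_comm he t)
  compact_equivariant g t := (hd.compact_compression_equivariant he g).mul_right _

theorem IsCycle.isInvariant_compression (hd : d.IsCycle α γ i) (he : IsUnitElement e)
    (h : d.IsInvariant) : (hd.compression he).IsInvariant := fun g => by
  refine ContinuousLinearMap.ext fun x : fixedSpace (d.η e) => Subtype.ext ?_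
  exact DFunLike.congr_fun (hd.conj_V_normalizedOp he h g) (x : d.H)

end Compression

/-! ### The homotopy from a cycle to its compression -/

section Homotopy

/-- The function `s ↦ 1 - s`. -/
def fade : C(unitInterval, ℂ) := ⟨fun s => ((1 - (s : ℝ) : ℝ) : ℂ), by fun_prop⟩

theorem star_fade : star fade = fade := by
  ext s
  exact Complex.conj_ofReal _

@[simp] theorem fade_zero : fade 0 = 1 := by simp [fade]

@[simp] theorem fade_one : fade 1 = 0 := by simp [fade]

open EndpointModule

/-- The path `(1 - s)² φ + (1 - (1 - s)²) φ'` of operators, which joins `φ` to the normalized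
operator `φ'`. The quadratic parametrization makes the coefficient of `φ` the square of a function
which vanishes at `1`. -/
def joinOp (he : IsUnitElement e) (T : d.H →L[ℂ] d.H) :
    EndpointModule (d.η e) →L[ℂ] EndpointModule (d.η e) :=
  fieldOp (fade * fade) T (fun x _ => by simp) +
    fieldOp (1 - fade * fade) (d.normalizedOp e)
      fun x hx => by rw [normalizedOp_preserves he x hx]

theorem joinOp_apply (he : IsUnitElement e) (T : d.H →L[ℂ] d.H) (f : EndpointModule (d.η e))
    (s : unitInterval) : joinOp he T f s =
      (fade s * fade s) • T (f s) + (1 - fade s * fade s) • d.normalizedOp e (f s) := rfl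

theorem inner_joinOp_left (he : IsUnitElement e) (T : d.H →L[ℂ] d.H)
    (f g : EndpointModule (d.η e)) :
    Inner.inner C(unitInterval, ℂ) (joinOp he T f) g =
      Inner.inner C(unitInterval, ℂ) f (joinOp he (star T) g) := by
  have h : star (fade * fade) = fade * fade := by rw [star_mul, star_fade]
  simp only [joinOp, _root_.add_apply, CStarModule.inner_add_left, CStarModule.inner_add_right]
  rw [inner_fieldOp_left h rfl _ (fun x _ => by simp),
    inner_fieldOp_left (by rw [star_sub, star_one, h]) (star_normalizedOp he)]

variable (d) in
/-- The representation of `A` on the module of paths by constant families of operators. -/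
def pathRep (he : IsUnitElement e) :
    A →ₙₐ[ℂ] (EndpointModule (d.η e) →L[ℂ] EndpointModule (d.η e)) where
  toFun t := fieldOp 1 (d.η t) fun x hx => by rw [η_preserves he t x hx]
  map_smul' c t := by ext f s; simp
  map_zero' := by ext f s; simp; rfl
  map_add' s t := by ext f r; simp
  map_mul' s t := by ext f r; simp

@[simp] theorem pathRep_apply (he : IsUnitElement e) (t : A) (f : EndpointModule (d.η e))
    (s : unitInterval) : d.pathRep he t f s = d.η t (f s) := one_smul ℂ _

theorem inner_pathRep_left (he : IsUnitElement e) (t : A) (f g : EndpointModule (d.η e)) :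
    Inner.inner C(unitInterval, ℂ) (d.pathRep he t f) g =
      Inner.inner C(unitInterval, ℂ) f (d.pathRep he (star t) g) :=
  inner_fieldOp_left (star_one _) (map_star d.η t).symm
    (fun x hx => by rw [η_preserves he t x hx])
    (fun x hx => by rw [η_preserves he (star t) x hx]) f g

theorem compactModuleOperators_of_eq_add {B E : Type*} [NormedRing B] [StarRing B] [NormedAlgebra ℂ B]
    [PartialOrder B] [NormedAddCommGroup E] [NormedSpace ℂ E] [SMul B E] [CStarModule B E]
    {S T R : E →L[ℂ] E} (h : S = T + R) (hT : T ∈ compactModuleOperators B E)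
    (hR : R ∈ compactModuleOperators B E) : S ∈ compactModuleOperators B E := by
  subst h
  exact (Submodule.span ℂ {T : E →L[ℂ] E | ∃ x y : E,
    ∀ z : E, T z = (Inner.inner B y z : B) • x}).topologicalClosure.add_mem hT hR

theorem joinOp_sub_mem_compact (hd : d.IsCycle α γ i) (he : IsUnitElement e) (t : A) :
    (joinOp he d.φ - joinOp he (star d.φ)) * d.pathRep he t ∈
      compactModuleOperators C(unitInterval, ℂ) (EndpointModule (d.η e)) := by
  have h := fieldOp_mem_compact_of_vanishing (P := d.η e) (c := fade * fade)
    (b := fade) (b' := fade) (by rw [star_fade]) fade_one fade_one (hd.compact_selfAdjoint t)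
    (fun x _ => by simp)
  convert h using 1
  ext f s
  change joinOp he d.φ (d.pathRep he t f) s - joinOp he (star d.φ) (d.pathRep he t f) s =
    (fade s * fade s) • (d.φ (d.η t (f s)) - star d.φ (d.η t (f s)))
  simp only [joinOp_apply, pathRep_apply]
  module

theorem joinOp_sq_mem_compact (hd : d.IsCycle α γ i) (he : IsUnitElement e) (t : A) :
    (joinOp he d.φ * joinOp he d.φ - 1) * d.pathRep he t ∈
      compactModuleOperators C(unitInterval, ℂ) (EndpointModule (d.η e)) := by
  have hP := star_η_unit (d := d) he
  have hPP := η_unit_mul (d := d) he e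
  have hsq := (hd.compact_normalizedOp_sq he).mul_right (d.η t)
  rw [mul_assoc, η_unit_mul he] at hsq
  have hmix := (hd.compact_normalizedOp_mixed he).mul_right (d.η t)
  rw [mul_assoc, η_unit_mul he] at hmix
  have h₀ := fieldOp_mem_compact_of_vanishing (P := d.η e)
    (c := fade * (fade * fade * fade)) (b := fade) (b' := fade * fade * fade)
    (by rw [star_mul, star_mul, star_fade, mul_assoc]) fade_one (by simp) (hd.compact_sq t)
    (fun x _ => by simp)
  have h₁ := fieldOp_mem_compact_of_vanishing (P := d.η e)
    (c := fade * ((1 - fade * fade) * fade)) (b := fade) (b' := (1 - fade * fade) * fade)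
    (by rw [star_mul, star_sub, star_one, star_mul, star_fade, mul_comm fade (1 - fade * fade)])
    fade_one (by simp) hmix (fun x _ => by simp)
  have hPK : d.η e * ((d.normalizedOp e * d.normalizedOp e - 1) * d.η t) =
      (d.normalizedOp e * d.normalizedOp e - 1) * d.η t := by
    simp only [sub_mul, mul_sub, one_mul]
    rw [← mul_assoc, ← mul_assoc, η_unit_mul_normalizedOp he, η_unit_mul he]
  have h₂ := fieldOp_mem_compact_of_compressed (P := d.η e) hP hPP
    ((1 - fade * fade) * (1 - fade * fade)) hsq hPK (by rw [mul_assoc, mul_η_unit he])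
    (fun x _ => congrArg _ (DFunLike.congr_fun hPK x))
  refine compactModuleOperators_of_eq_add ?_ (compactModuleOperators_of_eq_add rfl h₀ h₁) h₂
  ext f s
  have h2 : (2 : d.H →L[ℂ] d.H) (d.η t (f s)) = d.η t (f s) + d.η t (f s) := by
    rw [← one_add_one_eq_two]
    rfl
  change joinOp he d.φ (joinOp he d.φ (d.pathRep he t f)) s - d.pathRep he t f s =
    (fade s * (fade s * fade s * fade s)) • (d.φ (d.φ (d.η t (f s))) - d.η t (f s)) +
      (fade s * ((1 - fade s * fade s) * fade s)) •
        (d.φ (d.normalizedOp e (d.η t (f s))) + d.normalizedOp e (d.φ (d.η t (f s))) -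
          (2 : d.H →L[ℂ] d.H) (d.η t (f s))) +
      ((1 - fade s * fade s) * (1 - fade s * fade s)) •
        (d.normalizedOp e (d.normalizedOp e (d.η t (f s))) - d.η t (f s))
  simp only [joinOp_apply, pathRep_apply, map_add, map_smul, h2]
  module

theorem joinOp_comm_mem_compact (hd : d.IsCycle α γ i) (he : IsUnitElement e) (t : A) :
    joinOp he d.φ * d.pathRep he t - d.pathRep he (γ t) * joinOp he d.φ ∈
      compactModuleOperators C(unitInterval, ℂ) (EndpointModule (d.η e)) := by
  have h₀ := fieldOp_mem_compact_of_vanishing (P := d.η e) (c := fade * fade)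
    (b := fade) (b' := fade) (by rw [star_fade]) fade_one fade_one (hd.compact_comm t)
    (fun x _ => by simp)
  have hPK : d.η e * (d.normalizedOp e * d.η t - d.η (γ t) * d.normalizedOp e) =
      d.normalizedOp e * d.η t - d.η (γ t) * d.normalizedOp e := by
    rw [mul_sub, ← mul_assoc, ← mul_assoc, η_unit_mul_normalizedOp he, η_unit_mul he]
  have h₁ := fieldOp_mem_compact_of_compressed (P := d.η e) (star_η_unit he) (η_unit_mul he e)
    (1 - fade * fade) (hd.compact_normalizedOp_comm he t) hPK
    (by rw [sub_mul, mul_assoc, mul_assoc, normalizedOp_mul_η_unit he, mul_η_unit he])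
    (fun x _ => congrArg _ (DFunLike.congr_fun hPK x))
  refine compactModuleOperators_of_eq_add ?_ h₀ h₁
  ext f s
  change joinOp he d.φ (d.pathRep he t f) s - d.pathRep he (γ t) (joinOp he d.φ f) s =
    (fade s * fade s) • (d.φ (d.η t (f s)) - d.η (γ t) (d.φ (f s))) +
      (1 - fade s * fade s) •
        (d.normalizedOp e (d.η t (f s)) - d.η (γ t) (d.normalizedOp e (f s)))
  simp only [joinOp_apply, pathRep_apply, map_add, map_smul]
  module

theorem joinOp_equivariant_mem_compact (hd : d.IsCycle α γ i) (he : IsUnitElement e) (g : G)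
    (t : A) :
    ((mapUnitary (d.V g) (hd.η_unit_V he g) : EndpointModule (d.η e) →L[ℂ] _) ∘L
      joinOp he d.φ ∘L
        ((mapUnitary (d.V g) (hd.η_unit_V he g)).symm : EndpointModule (d.η e) →L[ℂ] _) -
      joinOp he d.φ) * d.pathRep he t ∈
      compactModuleOperators C(unitInterval, ℂ) (EndpointModule (d.η e)) := by
  have h₀ := fieldOp_mem_compact_of_vanishing (P := d.η e) (c := fade * fade)
    (b := fade) (b' := fade) (by rw [star_fade]) fade_one fade_one (hd.compact_equivariant g t)
    (fun x _ => by simp)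
  have hconj : d.η e * (d.V g).conjStarAlgEquiv (d.normalizedOp e) =
      (d.V g).conjStarAlgEquiv (d.normalizedOp e) := by
    conv_lhs => rw [← hd.conj_V_η_unit he g, ← map_mul, η_unit_mul_normalizedOp he]
  have hPK : d.η e * (((d.V g).conjStarAlgEquiv (d.normalizedOp e) - d.normalizedOp e) * d.η t) =
      ((d.V g).conjStarAlgEquiv (d.normalizedOp e) - d.normalizedOp e) * d.η t := by
    rw [← mul_assoc, mul_sub, hconj, η_unit_mul_normalizedOp he]
  have h₁ := fieldOp_mem_compact_of_compressed (P := d.η e) (star_η_unit he) (η_unit_mul he e)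
    (1 - fade * fade) ((hd.compact_normalizedOp_equivariant he g).mul_right (d.η t)) hPK
    (by rw [mul_assoc, mul_η_unit he])
    (fun x _ => congrArg _ (DFunLike.congr_fun hPK x))
  refine compactModuleOperators_of_eq_add ?_ h₀ h₁
  ext f s
  change d.V g ((fade s * fade s) • d.φ ((d.V g).symm (d.pathRep he t f s)) +
      (1 - fade s * fade s) • d.normalizedOp e ((d.V g).symm (d.pathRep he t f s))) -
      ((fade s * fade s) • d.φ (d.pathRep he t f s) +
        (1 - fade s * fade s) • d.normalizedOp e (d.pathRep he t f s)) =
    (fade s * fade s) • (d.V g (d.φ ((d.V g).symm (d.η t (f s)))) - d.φ (d.η t (f s))) +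
      (1 - fade s * fade s) • (d.V g (d.normalizedOp e ((d.V g).symm (d.η t (f s)))) -
        d.normalizedOp e (d.η t (f s)))
  rw [pathRep_apply, map_add, map_smul, map_smul]
  module

/-- The homotopy from a cycle to its compression. -/
def IsCycle.compressionFamily (hd : d.IsCycle α γ i) (he : IsUnitElement e) :
    KasparovFamily.{u, w, v} A G where
  E := EndpointModule (d.η e)
  η := d.pathRep he
  η_star := inner_pathRep_left he
  V :=
    { toFun := fun g => mapUnitary (d.V g) (hd.η_unit_V he g)
      map_one' := by ext f s; simp
      map_mul' := fun g h => by ext f s; simp }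
  V_inner g x y := by ext s; exact (d.V g).inner_map_map _ _
  Γ := mapUnitary d.Γ (hd.η_unit_Γ he)
  Γ_inner x y := by ext s; exact d.Γ.inner_map_map _ _
  φ := joinOp he d.φ
  φadj := joinOp he (star d.φ)
  φ_adj := inner_joinOp_left he d.φ

theorem IsCycle.isCycle_compressionFamily (hd : d.IsCycle α γ i) (he : IsUnitElement e) :
    (hd.compressionFamily he).IsCycle α γ i where
  covariant g t := by
    refine ContinuousLinearMap.ext fun f : EndpointModule (d.η e) =>
      EndpointModule.ext fun s => ?_
    change (1 : ℂ) • d.η (α g t) (f s) = d.V g ((1 : ℂ) • d.η t ((d.V g).symm (f s)))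
    rw [one_smul, one_smul, hd.covariant]
    rfl
  grading_sq f := EndpointModule.ext fun s => hd.grading_sq _
  grading_comm g f := EndpointModule.ext fun s => hd.grading_comm g _
  graded t := by
    refine ContinuousLinearMap.ext fun f : EndpointModule (d.η e) =>
      EndpointModule.ext fun s => ?_
    change (1 : ℂ) • d.η (γ t) (f s) = d.Γ ((1 : ℂ) • d.η t (d.Γ.symm (f s)))
    rw [one_smul, one_smul, hd.graded]
    rfl
  even hi := by
    refine ContinuousLinearMap.ext fun f : EndpointModule (d.η e) =>
      EndpointModule.ext fun s => ?_
    have h₀ : d.Γ (d.φ (d.Γ.symm (f s))) = -d.φ (f s) := DFunLike.congr_fun (hd.even hi) (f s)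
    have h₁ : d.Γ (d.normalizedOp e (d.Γ.symm (f s))) = -d.normalizedOp e (f s) :=
      DFunLike.congr_fun (hd.conj_Γ_normalizedOp he hi) (f s)
    change d.Γ ((fade s * fade s) • d.φ (d.Γ.symm (f s)) +
      (1 - fade s * fade s) • d.normalizedOp e (d.Γ.symm (f s))) =
      -((fade s * fade s) • d.φ (f s) + (1 - fade s * fade s) • d.normalizedOp e (f s))
    rw [map_add, map_smul, map_smul, h₀, h₁]
    module
  odd hi f := EndpointModule.ext fun s => hd.odd hi _
  compact_selfAdjoint := joinOp_sub_mem_compact hd he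
  compact_sq := joinOp_sq_mem_compact hd he
  compact_comm := joinOp_comm_mem_compact hd he
  compact_equivariant := joinOp_equivariant_mem_compact hd he

theorem IsCycle.isInvariant_compressionFamily (hd : d.IsCycle α γ i) (he : IsUnitElement e)
    (h : d.IsInvariant) : (hd.compressionFamily he).IsInvariant := fun g => by
  refine ContinuousLinearMap.ext fun f : EndpointModule (d.η e) =>
    EndpointModule.ext fun s => ?_
  have h₀ : d.V g (d.φ ((d.V g).symm (f s))) = d.φ (f s) := DFunLike.congr_fun (h g) (f s)
  have h₁ : d.V g (d.normalizedOp e ((d.V g).symm (f s))) = d.normalizedOp e (f s) :=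
    DFunLike.congr_fun (hd.conj_V_normalizedOp he h g) (f s)
  change d.V g ((fade s * fade s) • d.φ ((d.V g).symm (f s)) +
    (1 - fade s * fade s) • d.normalizedOp e ((d.V g).symm (f s))) =
    (fade s * fade s) • d.φ (f s) + (1 - fade s * fade s) • d.normalizedOp e (f s)
  rw [map_add, map_smul, map_smul, h₀, h₁]

theorem IsCycle.compressionFamily_evaluatesTo_zero (hd : d.IsCycle α γ i)
    (he : IsUnitElement e) : (hd.compressionFamily he).EvaluatesTo 0 d := by
  let q : EndpointModule (d.η e) →ₗ[ℂ] d.H :=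
    { toFun := fun f => f 0
      map_add' := fun _ _ => rfl
      map_smul' := fun _ _ => rfl }
  have hq : Function.Surjective q := fun x =>
    ⟨EndpointModule.mk (fun s => fade s • x) (by fun_prop) (by rw [fade_one, zero_smul, map_zero]), by
      change fade 0 • x = x
      rw [fade_zero, one_smul]⟩
  refine ⟨q, hq.denseRange, fun f g => rfl, fun t f => one_smul ℂ _, fun g f => rfl,
    fun f => rfl, fun f => ?_⟩
  exact (joinOp_apply he d.φ f 0).trans (by
    rw [fade_zero, one_mul, sub_self, one_smul, zero_smul, add_zero]
    rfl)

theorem IsCycle.compressionFamily_evaluatesTo_one (hd : d.IsCycle α γ i)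
    (he : IsUnitElement e) : (hd.compressionFamily he).EvaluatesTo 1 (hd.compression he) := by
  let q : EndpointModule (d.η e) →ₗ[ℂ] fixedSpace (d.η e) :=
    { toFun := fun f => ⟨f 1, f.apply_one⟩
      map_add' := fun _ _ => rfl
      map_smul' := fun _ _ => rfl }
  have hq : Function.Surjective q := fun x => ⟨EndpointModule.mk (fun _ => x) continuous_const x.2, rfl⟩
  refine ⟨q, hq.denseRange, fun f g => rfl, fun t f => Subtype.ext (one_smul ℂ _),
    fun g f => rfl, fun f => rfl, fun f => Subtype.ext ?_⟩
  exact (joinOp_apply he d.φ f 1).trans (by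
    rw [fade_one, mul_zero, sub_zero, zero_smul, one_smul, zero_add]
    rfl)

end Homotopy

end KasparovDatum

/-! ### Unitary equivalence of cycles -/

/-- Conjugation by a unitary as a *-morphism. -/
def unitaryConjHom {H H' : Type*} [NormedAddCommGroup H] [InnerProductSpace ℂ H]
    [CompleteSpace H] [NormedAddCommGroup H'] [InnerProductSpace ℂ H'] [CompleteSpace H']
    (W : H ≃ₗᵢ[ℂ] H') : (H →L[ℂ] H) →⋆ₙₐ[ℂ] (H' →L[ℂ] H') where
  toFun := W.conjStarAlgEquiv
  map_smul' := map_smul W.conjStarAlgEquiv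
  map_zero' := map_zero W.conjStarAlgEquiv
  map_add' := map_add W.conjStarAlgEquiv
  map_mul' := map_mul W.conjStarAlgEquiv
  map_star' := map_star W.conjStarAlgEquiv

section UnitaryEquivalence

variable {A : Type w} [NonUnitalCStarAlgebra A] {G : Type v} [Group G]
  {d d' : KasparovDatum.{u, w, v} A G}

theorem KasparovFamily.EvaluatesTo.of_unitarilyEquiv {𝓔 : KasparovFamily.{u, w, v} A G}
    {s : unitInterval} (h : 𝓔.EvaluatesTo s d) (hd : d.UnitarilyEquiv d') :
    𝓔.EvaluatesTo s d' := by
  obtain ⟨q, hq, hinner, hη, hV, hΓ, hφ⟩ := h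
  obtain ⟨W, Wη, WV, WΓ, Wφ⟩ := hd
  refine ⟨W.toLinearEquiv.toLinearMap ∘ₗ q, W.surjective.denseRange.comp hq W.continuous,
    fun x y => ?_, fun t x => ?_, fun g x => ?_, fun x => ?_, fun x => ?_⟩
  · exact (W.inner_map_map _ _).trans (hinner x y)
  · exact (congrArg W (hη t x)).trans (Wη t (q x))
  · exact (congrArg W (hV g x)).trans (WV g (q x))
  · exact (congrArg W (hΓ x)).trans (WΓ (q x))
  · exact (congrArg W (hφ x)).trans (Wφ (q x))

namespace KasparovDatum

theorem UnitarilyEquiv.symm (h : d.UnitarilyEquiv d') : d'.UnitarilyEquiv d := by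
  obtain ⟨W, hη, hV, hΓ, hφ⟩ := h
  refine ⟨W.symm, fun t x => ?_, fun g x => ?_, fun x => ?_, fun x => ?_⟩ <;>
    apply W.injective <;>
    simp only [hη, hV, hΓ, hφ, LinearIsometryEquiv.apply_symm_apply]

theorem conj_φ_of_equiv {W : d.H ≃ₗᵢ[ℂ] d'.H} (hW : ∀ x, W (d.φ x) = d'.φ (W x)) :
    d'.φ = W.conjStarAlgEquiv d.φ := by
  ext x
  rw [LinearIsometryEquiv.conjStarAlgEquiv_apply_apply, hW, W.apply_symm_apply]

theorem UnitarilyEquiv.star_φ (h : d.UnitarilyEquiv d') (hd : star d.φ = d.φ) :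
    star d'.φ = d'.φ := by
  obtain ⟨W, -, -, -, hW⟩ := h
  rw [conj_φ_of_equiv hW, ← map_star, hd]

theorem UnitarilyEquiv.compact_sq (h : d.UnitarilyEquiv d') (hd : IsCompactOp (d.φ * d.φ - 1)) :
    IsCompactOp (d'.φ * d'.φ - 1) := by
  obtain ⟨W, -, -, -, hW⟩ := h
  have := hd.conj W
  rwa [map_sub, map_mul, map_one, ← conj_φ_of_equiv hW] at this

theorem UnitarilyEquiv.compact_equivariant (h : d.UnitarilyEquiv d') {g : G}
    (hd : IsCompactOp ((d.V g).conjStarAlgEquiv d.φ - d.φ)) :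
    IsCompactOp ((d'.V g).conjStarAlgEquiv d'.φ - d'.φ) := by
  obtain ⟨W, -, hV, -, hW⟩ := h
  have h' : W.conjStarAlgEquiv ((d.V g).conjStarAlgEquiv d.φ) =
      (d'.V g).conjStarAlgEquiv d'.φ := by
    ext x
    have hx : (d'.V g) (W ((d.V g).symm (W.symm x))) = x := by
      rw [← hV, LinearIsometryEquiv.apply_symm_apply, W.apply_symm_apply]
    conv_rhs => rw [← hx]
    simp only [LinearIsometryEquiv.conjStarAlgEquiv_apply_apply,
      LinearIsometryEquiv.symm_apply_apply, hV, hW]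
  have := hd.conj W
  rwa [map_sub, h', ← conj_φ_of_equiv hW] at this

end KasparovDatum

end UnitaryEquivalence

/-! ### Paths, parallel transport and frames -/

namespace PosetPath

variable {K : Type u} [PartialOrder K] {a o o' o'' : K}

theorem opp_opp (p : PosetPath a o) : p.opp.opp = p := by
  induction p with
  | single b => rfl
  | cons b p ih => rw [opp, opp_comp, ih]; rfl

theorem comp_opp_self (p : PosetPath a o) : Homotopy (p.comp p.opp) (triv o) := by
  have h := opp_comp_self p.opp
  rwa [opp_opp] at h

/-- A choice of paths from `a` to all elements identifies a path `q : o → o'` with a loop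
over `a`. -/
def toLoop (f : ∀ o, PosetPath a o) (q : PosetPath o o') : PosetPi1 a :=
  PosetPi1.mk ((f o').opp.comp (q.comp (f o)))

variable (f : ∀ o, PosetPath a o)

theorem toLoop_congr {q q' : PosetPath o o'} (h : Homotopy q q') :
    toLoop f q = toLoop f q' :=
  Quotient.sound (Homotopy.comp (Homotopy.refl _) (Homotopy.comp h (Homotopy.refl _)))

theorem toLoop_comp (q' : PosetPath o' o'') (q : PosetPath o o') :
    toLoop f (q'.comp q) = toLoop f q' * toLoop f q := by
  refine Quotient.sound (Homotopy.symm ?_)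
  rw [comp_assoc, comp_assoc, comp_assoc, ← comp_assoc (f o')]
  refine Homotopy.comp (Homotopy.refl _) (Homotopy.comp (Homotopy.refl _) ?_)
  exact (Homotopy.comp (comp_opp_self (f o')) (Homotopy.refl _)).trans (triv_comp _)

theorem toLoop_loop (hf : f a = triv a) (q : PosetPath a a) : toLoop f q = PosetPi1.mk q := by
  refine Quotient.sound ?_
  rw [hf]
  exact (triv_comp _).trans (comp_triv q)

theorem toLoop_ofLE_trans (h : o ≤ o') (h' : o' ≤ o'') :
    toLoop f (ofLE h') * toLoop f (ofLE h) = toLoop f (ofLE (h.trans h')) := by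
  rw [← toLoop_comp]
  exact toLoop_congr f (Homotopy.deform (⟨o'', h', le_rfl⟩ : PosetSimplex o' o'')
    ⟨o'', h.trans h', le_rfl⟩ (⟨o', h, le_rfl⟩ : PosetSimplex o o') o'' le_rfl le_rfl h').symm

theorem toLoop_single (b : PosetSimplex o o') :
    toLoop f (ofLE b.le₀) * toLoop f (single b) = toLoop f (ofLE b.le₁) := by
  rw [← toLoop_comp]
  exact toLoop_congr f (Homotopy.deform (⟨b.supp, b.le₀, le_rfl⟩ : PosetSimplex o' b.supp)
    ⟨b.supp, b.le₁, le_rfl⟩ b b.supp le_rfl le_rfl le_rfl).symm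

end PosetPath

/-- In a pathwise connected poset there is a family of paths starting at `a`, with the trivial path
to `a`. -/
theorem PathwiseConnected.exists_frame {K : Type u} [PartialOrder K] (hK : PathwiseConnected K)
    (a : K) : ∃ f : ∀ o, PosetPath a o, f a = PosetPath.triv a := by
  classical
  exact ⟨Function.update (fun o => (hK a o).some) a (PosetPath.triv a), Function.update_self _ _ _⟩

namespace CStarNetBundle

variable {K : Type u} [PartialOrder K] (𝓑 : CStarNetBundle K) {a o : K}

theorem along_triv (x : 𝓑.fiber a) : 𝓑.along (PosetPath.triv a) x = x :=
  (𝓑.along_ofLE le_rfl x).trans (𝓑.incl_self a x)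

theorem along_along_opp (p : PosetPath a o) (x : 𝓑.fiber o) :
    𝓑.along p (𝓑.along p.opp x) = x := by
  have h := 𝓑.along_homotopy (PosetPath.comp_opp_self p)
  rw [along_comp] at h
  exact (DFunLike.congr_fun h x).trans (𝓑.along_triv x)

end CStarNetBundle

namespace HilbertNetBundle

variable {K : Type u} [PartialOrder K] (ℋ : HilbertNetBundle K) {a o o' : K}

theorem along_triv (x : ℋ.fiber a) : ℋ.along (PosetPath.triv a) x = x :=
  (ℋ.U le_rfl).symm_apply_apply x

theorem along_ofLE (h : o ≤ o') (x : ℋ.fiber o) : ℋ.along (PosetPath.ofLE h) x = ℋ.U h x := by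
  change (ℋ.U (le_refl o')).symm (ℋ.U h x) = _
  apply (ℋ.U (le_refl o')).injective
  rw [LinearIsometryEquiv.apply_symm_apply, ℋ.U_U]

theorem along_opp (p : PosetPath a o) : ℋ.along p.opp = (ℋ.along p).symm := by
  ext x
  have h := ℋ.along_homotopy (PosetPath.comp_opp_self p)
  rw [along_comp] at h
  apply (ℋ.along p).injective
  rw [LinearIsometryEquiv.apply_symm_apply]
  exact (DFunLike.congr_fun h x).trans (ℋ.along_triv x)

theorem adBundle_along (p : PosetPath a o) (T : ℋ.fiber a →L[ℂ] ℋ.fiber a) :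
    ℋ.adBundle.along p T = (ℋ.along p).conjStarAlgEquiv T := by
  induction p with
  | single b => rfl
  | cons b p ih => exact congrArg (ℋ.adBundle.alongSimplex b) ih

end HilbertNetBundle

/-- A family of linear maps which intertwines the inclusion maps of two Hilbert net bundles
intertwines the parallel transports. -/
theorem HilbertNetBundle.map_along {K : Type u} [PartialOrder K] {ℋ ℋ' : HilbertNetBundle K}
    (T : ∀ o, ℋ.fiber o → ℋ'.fiber o)
    (hT : ∀ {o o' : K} (h : o ≤ o') (x : ℋ.fiber o), T o' (ℋ.U h x) = ℋ'.U h (T o x))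
    {a o : K} (p : PosetPath a o) (x : ℋ.fiber a) :
    T o (ℋ.along p x) = ℋ'.along p (T a x) := by
  have hs : ∀ {b c : K} (q : PosetSimplex b c) (y : ℋ.fiber b),
      T c (ℋ.alongSimplex q y) = ℋ'.alongSimplex q (T b y) := by
    intro b c q y
    apply (ℋ'.U q.le₀).injective
    rw [← hT]
    change T q.supp (ℋ.U q.le₀ ((ℋ.U q.le₀).symm (ℋ.U q.le₁ y))) =
      ℋ'.U q.le₀ ((ℋ'.U q.le₀).symm (ℋ'.U q.le₁ (T b y)))
    rw [LinearIsometryEquiv.apply_symm_apply, LinearIsometryEquiv.apply_symm_apply, hT]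
  induction p with
  | single b => exact hs b x
  | cons b p ih => exact (hs b _).trans (congrArg _ ih)

/-! ### The enveloping net bundle -/

namespace CStarNet

variable {K : Type u} [PartialOrder K] (𝒜 : CStarNet.{u, u} K) {a o : K}

/-- The fibres of the enveloping net bundle are generated by the elements `ȷ̄_p (ε_o t)`. -/
theorem envelope_induction (S : NonUnitalStarSubalgebra ℂ (𝒜.envelope.fiber a))
    (hS : IsClosed (S : Set (𝒜.envelope.fiber a)))
    (h : ∀ (o : K) (p : PosetPath o a) (t : 𝒜.fiber o),
      𝒜.envelope.along p (𝒜.canonicalMor.hom o t) ∈ S) (x : 𝒜.envelope.fiber a) : x ∈ S := by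
  let S' : NonUnitalStarSubalgebra ℂ (𝒜.TargetProd a) :=
    NonUnitalStarSubalgebra.map (NonUnitalStarSubalgebraClass.subtype (𝒜.envelopeAlg a)) S
  have hS' : IsClosed (S' : Set (𝒜.TargetProd a)) :=
    (𝒜.isClosed_envelopeAlg a).isClosedEmbedding_subtypeVal.isClosedMap _ hS
  have hle : 𝒜.envelopeAlg a ≤ S' := 𝒜.envelopeAlg_le S' hS' fun o p t =>
    ⟨𝒜.envelope.along p (𝒜.canonicalMor.hom o t), h o p t, 𝒜.along_canonicalMor p t⟩
  obtain ⟨y, hy, hyx⟩ := hle x.2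
  have : y = x := Subtype.ext hyx
  rw [← this]
  exact hy

theorem along_canonicalMor_one (p : PosetPath o a) :
    𝒜.envelope.along p (𝒜.canonicalMor.hom o 1) = 𝒜.canonicalMor.hom a 1 := by
  have hs : ∀ {b c : K} (q : PosetSimplex b c),
      𝒜.envelope.alongSimplex q (𝒜.canonicalMor.hom b 1) = 𝒜.canonicalMor.hom c 1 := by
    intro b c q
    apply EquivLike.injective (𝒜.envelope.incl q.le₀)
    rw [𝒜.canonicalMor.comm, map_one (𝒜.incl q.le₀)]
    refine (StarAlgEquiv.apply_symm_apply (𝒜.envelope.incl q.le₀) _).trans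
      ((𝒜.canonicalMor.comm q.le₁ 1).trans ?_)
    rw [map_one (𝒜.incl q.le₁)]
  induction p with
  | single b => exact hs b
  | cons b p ih => exact (congrArg _ ih).trans (hs b)

/-- The fibres of the enveloping net bundle are unital: all elements `(p, 1)` coincide. -/
theorem isUnitElement_canonicalMor_one (a : K) :
    IsUnitElement (𝒜.canonicalMor.hom a 1) := by
  have hstar : star (𝒜.canonicalMor.hom a 1) = 𝒜.canonicalMor.hom a 1 := by
    rw [← map_star, star_one]
  let S : NonUnitalStarSubalgebra ℂ (𝒜.envelope.fiber a) :=
    { carrier := {x | 𝒜.canonicalMor.hom a 1 * x = x ∧ x * 𝒜.canonicalMor.hom a 1 = x}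
      add_mem' := fun {x y} hx hy => ⟨by rw [mul_add, hx.1, hy.1], by rw [add_mul, hx.2, hy.2]⟩
      zero_mem' := ⟨mul_zero _, zero_mul _⟩
      mul_mem' := fun {x y} hx hy => ⟨by rw [← mul_assoc, hx.1], by rw [mul_assoc, hy.2]⟩
      smul_mem' := fun c x hx =>
        ⟨by rw [mul_smul_comm, hx.1], by rw [smul_mul_assoc, hx.2]⟩
      star_mem' := fun {x} hx => ⟨by rw [← hstar, ← star_mul, hx.2],
        by rw [← hstar, ← star_mul, hx.1]⟩ }
  refine 𝒜.envelope_induction S ?_ fun o p t => ?_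
  · exact (isClosed_eq (continuous_const_mul _) continuous_id).inter
      (isClosed_eq (continuous_mul_const _) continuous_id)
  · change _ * _ = _ ∧ _ * _ = _
    rw [← 𝒜.along_canonicalMor_one p]
    exact ⟨by rw [← map_mul, ← map_mul, one_mul], by rw [← map_mul, ← map_mul, mul_one]⟩

theorem envelope_along_apply (p : PosetPath o a) (x : 𝒜.envelope.fiber o) (τ : 𝒜.Target) :
    (𝒜.envelope.along p x).1 τ = τ.bundle.along p (x.1 τ) := by
  induction p with
  | single b => rfl
  | cons b p ih => exact congrArg (τ.bundle.alongSimplex b) ih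

theorem lift_along {𝓑 : CStarNetBundle.{u, u} K} (ψ : NetMorphism 𝒜 𝓑) (p : PosetPath o a)
    (x : 𝒜.envelope.fiber o) :
    𝒜.lift ψ a (𝒜.envelope.along p x) = 𝓑.along p (𝒜.lift ψ o x) :=
  𝒜.envelope_along_apply p x ⟨𝓑, ψ⟩

theorem lift_canonicalMor {𝓑 : CStarNetBundle.{u, u} K} (ψ : NetMorphism 𝒜 𝓑) (t : 𝒜.fiber o) :
    𝒜.lift ψ o (𝒜.canonicalMor.hom o t) = ψ.hom o t :=
  𝒜.canonicalElem_triv_apply t ⟨𝓑, ψ⟩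

variable {𝒜}

theorem Grading.envelopeAut_along (β : 𝒜.Grading) (p : PosetPath o a)
    (x : 𝒜.envelope.fiber o) :
    β.envelopeAut a (𝒜.envelope.along p x) = 𝒜.envelope.along p (β.envelopeAut o x) :=
  Subtype.ext (lp.ext (funext fun τ =>
    (𝒜.envelope_along_apply p x (β.twist τ)).trans
      (𝒜.envelope_along_apply p (β.envelopeAut o x) τ).symm))

end CStarNet

/-! ### The cycle of a Fredholm module -/

namespace GradedRepresentation

variable {K : Type u} [PartialOrder K] {𝒜 : CStarNet.{u, u} K} {β : 𝒜.Grading}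
  (R : GradedRepresentation 𝒜 β) {a o : K}

theorem Γ_along (p : PosetPath o a) (x : R.bundle.fiber o) :
    R.Γ a (R.bundle.along p x) = R.bundle.along p (R.Γ o x) :=
  HilbertNetBundle.map_along (fun o => R.Γ o) (fun h x => R.Γ_comm h x) p x

/-- The lift `π_*` of the representation to the fibre `𝒜̄_a` of the enveloping net bundle. -/
def lift (a : K) : 𝒜.envelope.fiber a →⋆ₙₐ[ℂ] (R.bundle.fiber a →L[ℂ] R.bundle.fiber a) :=
  𝒜.lift R.rep a

/-- The lift `π_*` on generators: `π_*(ȷ̄_p ε_o(t)) = ad U_p (π_o t)`. -/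
theorem lift_generator (p : PosetPath o a) (t : 𝒜.fiber o) :
    R.lift a (𝒜.envelope.along p (𝒜.canonicalMor.hom o t)) =
      (R.bundle.along p).conjStarAlgEquiv (R.op o t) := by
  refine (𝒜.lift_along R.rep p _).trans ?_
  rw [𝒜.lift_canonicalMor]
  exact R.bundle.adBundle_along p _

theorem lift_covariant (g : PosetPi1 a) (t : 𝒜.envelope.fiber a) :
    R.lift a (𝒜.envelope.holonomy a g t) =
      (R.bundle.holonomy a g).conjStarAlgEquiv (R.lift a t) := by
  obtain ⟨q⟩ := g
  exact (𝒜.lift_along R.rep q t).trans (R.bundle.adBundle_along q _)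

theorem envelopeAut_generator (p : PosetPath o a) (t : 𝒜.fiber o) :
    β.envelopeAut a (𝒜.envelope.along p (𝒜.canonicalMor.hom o t)) =
      𝒜.envelope.along p (𝒜.canonicalMor.hom o (β.aut o t)) := by
  rw [β.envelopeAut_along, β.envelopeAut_canonicalMor]

theorem lift_graded (t : 𝒜.envelope.fiber a) :
    R.lift a (β.envelopeAut a t) = (R.Γ a).conjStarAlgEquiv (R.lift a t) := by
  let Φ : 𝒜.envelope.fiber a →⋆ₙₐ[ℂ] (R.bundle.fiber a →L[ℂ] R.bundle.fiber a) :=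
    (R.lift a).comp (β.envelopeAut a : 𝒜.envelope.fiber a →⋆ₙₐ[ℂ] 𝒜.envelope.fiber a)
  let Ψ : 𝒜.envelope.fiber a →⋆ₙₐ[ℂ] (R.bundle.fiber a →L[ℂ] R.bundle.fiber a) :=
    (unitaryConjHom (R.Γ a)).comp (R.lift a)
  have h : Φ = Ψ := 𝒜.envelope_hom_ext fun o p t => by
    change R.lift a (β.envelopeAut a _) =
      (R.Γ a).conjStarAlgEquiv (R.lift a _)
    rw [envelopeAut_generator, R.lift_generator, R.lift_generator]
    change (R.bundle.along p).conjStarAlgEquiv (R.rep.hom o (β.aut o t)) = _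
    rw [R.graded]
    ext x
    have hx : (R.Γ o).symm ((R.bundle.along p).symm x) =
        (R.bundle.along p).symm ((R.Γ a).symm x) := by
      apply (R.bundle.along p).injective
      apply (R.Γ a).injective
      rw [R.Γ_along]
      simp only [LinearIsometryEquiv.apply_symm_apply]
    change R.bundle.along p (R.Γ o (R.op o t ((R.Γ o).symm ((R.bundle.along p).symm x)))) =
      R.Γ a (R.bundle.along p (R.op o t ((R.bundle.along p).symm ((R.Γ a).symm x))))
    rw [R.Γ_along, hx]
  exact DFunLike.congr_fun h t

/-- The graded commutators of an operator with a representation are compact as soon as this holds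
for the generators of the enveloping algebra. -/
theorem compact_comm_of_generators (F : R.bundle.fiber a →L[ℂ] R.bundle.fiber a)
    (hF : star F = F)
    (h : ∀ (o : K) (p : PosetPath o a) (t : 𝒜.fiber o),
      IsCompactOp (F * (R.bundle.along p).conjStarAlgEquiv (R.op o t) -
        (R.bundle.along p).conjStarAlgEquiv (R.op o (β.aut o t)) * F))
    (t : 𝒜.envelope.fiber a) :
    IsCompactOp (F * R.lift a t - R.lift a (β.envelopeAut a t) * F) := by
  let γ := β.envelopeAut a
  let η := R.lift a
  have hγ : ∀ t, γ (γ t) = t := β.envelopeHom_envelopeHom a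
  let C : 𝒜.envelope.fiber a → Prop := fun t => IsCompactOp (F * η t - η (γ t) * F)
  have hηc : Continuous η := AddMonoidHomClass.continuous_of_bound η 1 fun y => by
    simpa using NonUnitalStarAlgHom.norm_apply_le η y
  have hγc : Continuous γ := AddMonoidHomClass.continuous_of_bound γ 1 fun y => by
    simpa using NonUnitalStarAlgHom.norm_apply_le γ y
  have hCclosed : IsClosed {t | C t} :=
    (isClosed_setOfPred_isCompactOperator (𝕜₁ := ℂ) (𝕜₂ := ℂ) (σ₁₂ := RingHom.id ℂ)
      (M₁ := R.bundle.fiber a) (M₂ := R.bundle.fiber a)).preimage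
      (f := fun t => F * η t - η (γ t) * F)
      ((continuous_const.mul hηc).sub ((hηc.comp hγc).mul continuous_const))
  have hadd : ∀ s t, C s → C t → C (s + t) := fun s t hs ht => by
    refine IsCompactOp.of_eq_add ?_ hs ht
    rw [map_add, map_add, map_add]
    noncomm_ring
  have hmul : ∀ s t, C s → C t → C (s * t) := fun s t hs ht => by
    refine IsCompactOp.of_eq_add ?_ (hs.mul_right (η t)) (ht.mul_left (η (γ s)))
    rw [map_mul, map_mul, map_mul]
    noncomm_ring
  have hsmul : ∀ (c : ℂ) t, C t → C (c • t) := fun c t ht => by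
    have h' := IsCompactOp.mul_left ht (c • 1)
    change IsCompactOp _
    rw [map_smul, map_smul, map_smul, mul_smul_comm, smul_mul_assoc, ← smul_sub]
    rwa [smul_mul_assoc, one_mul] at h'
  -- The adjoint of the graded commutator with `t` is minus the one with `γ (star t)`; hence
  -- compactness is required for `t` and `γ t` at the same time.
  have hstar : ∀ t, C (γ t) → C (star t) := fun t ht => by
    have h' := IsCompactOp.mul_left (IsCompactOp.star ht) (-1)
    rw [hγ, star_sub, star_mul, star_mul, hF, ← map_star, ← map_star, ← map_star, neg_mul, one_mul,
      neg_sub] at h'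
    exact h'
  let S : NonUnitalStarSubalgebra ℂ (𝒜.envelope.fiber a) :=
    { carrier := {t | C t ∧ C (γ t)}
      add_mem' := fun {s t} hs ht => ⟨hadd s t hs.1 ht.1, by
        rw [map_add]; exact hadd _ _ hs.2 ht.2⟩
      zero_mem' := by
        have h0 : C 0 := by
          change IsCompactOp _
          rw [map_zero, map_zero, map_zero, mul_zero, zero_mul, sub_zero]
          exact isCompactOperator_zero
        exact ⟨h0, by rwa [map_zero]⟩
      mul_mem' := fun {s t} hs ht => ⟨hmul s t hs.1 ht.1, by
        rw [map_mul]; exact hmul _ _ hs.2 ht.2⟩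
      smul_mem' := fun c t ht => ⟨hsmul c t ht.1, by rw [map_smul]; exact hsmul c _ ht.2⟩
      star_mem' := fun {t} ht => ⟨hstar t ht.2, by
        rw [map_star]; exact hstar _ (by rw [hγ]; exact ht.1)⟩ }
  have hgen : ∀ (o : K) (p : PosetPath o a) (t : 𝒜.fiber o),
      C (𝒜.envelope.along p (𝒜.canonicalMor.hom o t)) := fun o p t => by
    change IsCompactOp (F * R.lift a _ - R.lift a (β.envelopeAut a _) * F)
    rw [envelopeAut_generator, R.lift_generator, R.lift_generator]
    exact h o p t
  refine (𝒜.envelope_induction S (hCclosed.inter (hCclosed.preimage hγc)) (fun o p t =>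
    ⟨hgen o p t, ?_⟩) t).1
  have := hgen o p (β.aut o t)
  rwa [← envelopeAut_generator] at this

end GradedRepresentation

section Fredholm

variable {K : Type u} [PartialOrder K] {𝒜 : CStarNet.{u, u} K} {β : 𝒜.Grading} {i : Fin 2}

theorem LocalizedFredholmModule.isCycle_datum {a : K} (M : LocalizedFredholmModule 𝒜 β i a) :
    M.datum.IsCycle (𝒜.envelope.holonomy a) (β.envelopeAut a) i where
  covariant g t := M.lift_covariant g t
  grading_sq x := M.Γ_sq a x
  grading_comm g x := by
    obtain ⟨q⟩ := g
    exact (M.Γ_along q x).symm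
  graded t := M.lift_graded t
  even hi := M.even hi
  odd hi x := M.odd hi a x
  compact_selfAdjoint t := by
    have h : M.datum.φ - star M.datum.φ = 0 := sub_eq_zero.2 M.selfAdjoint.symm
    rw [h, zero_mul]
    exact isCompactOperator_zero
  compact_sq t := IsCompactOp.mul_right (T := M.F * M.F - 1) M.compact_sq (M.lift a t)
  compact_comm t := M.compact_comm_of_generators M.F M.selfAdjoint M.compact_comm t
  compact_equivariant g t := by
    obtain ⟨q⟩ := g
    exact IsCompactOp.mul_right (M.compact_equivariant q) (M.lift a t)

theorem FredholmModule.F_along (M : FredholmModule 𝒜 β i) {o a : K} (p : PosetPath o a)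
    (x : M.bundle.fiber o) : M.F a (M.bundle.along p x) = M.bundle.along p (M.F o x) :=
  HilbertNetBundle.map_along (fun o => M.F o) (fun h x => (M.parallel h x).symm) p x

theorem FredholmModule.conj_along_F (M : FredholmModule 𝒜 β i) {o a : K} (p : PosetPath o a) :
    (M.bundle.along p).conjStarAlgEquiv (M.F o) = M.F a := by
  ext x
  rw [LinearIsometryEquiv.conjStarAlgEquiv_apply_apply, ← M.F_along,
    LinearIsometryEquiv.apply_symm_apply]

/-- The localization of a Fredholm module in `a`: only the operator `F_a` is kept. -/
def FredholmModule.localize (M : FredholmModule 𝒜 β i) (a : K) :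
    LocalizedFredholmModule 𝒜 β i a where
  toGradedRepresentation := M.toGradedRepresentation
  F := M.F a
  even hi := M.even hi a
  odd := M.odd
  selfAdjoint := M.selfAdjoint a
  compact_sq := M.compact_sq a
  compact_comm o p t := by
    rw [← M.conj_along_F p, ← map_mul, ← map_mul, ← map_sub]
    exact (M.compact_comm o t).conj _
  compact_equivariant q := by
    rw [M.conj_along_F q, sub_self]
    exact isCompactOperator_zero

theorem FredholmModule.isCycle_datum (M : FredholmModule 𝒜 β i) (a : K) :
    (M.datum a).IsCycle (𝒜.envelope.holonomy a) (β.envelopeAut a) i :=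
  (M.localize a).isCycle_datum

theorem FredholmModule.isInvariant_datum (M : FredholmModule 𝒜 β i) (a : K) :
    (M.datum a).IsInvariant := by
  rintro ⟨q⟩
  exact M.conj_along_F q

end Fredholm

/-! ### Fredholm modules from cycles -/

namespace KasparovDatum

variable {K : Type u} [PartialOrder K] {𝒜 : CStarNet.{u, u} K} {β : 𝒜.Grading} {i : Fin 2} {a : K}
  {d : KasparovDatum.{u, u + 1, u} (𝒜.envelope.fiber a) (PosetPi1 a)}

open PosetPath

variable (d) in
/-- The Hilbert net bundle with constant fibre `H` and holonomy `V`: the unitaries are the values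
of `V` at the loops given by a choice of paths `f`. -/
def holonomyBundle (f : ∀ o, PosetPath a o) : HilbertNetBundle.{u, u} K where
  fiber _ := d.H
  U h := d.V (toLoop f (ofLE h))
  U_U h h' x := by
    rw [← toLoop_ofLE_trans f h h', map_mul]
    rfl

theorem holonomyBundle_along (f : ∀ o, PosetPath a o) {o o' : K} (p : PosetPath o o') :
    (d.holonomyBundle f).along p = d.V (toLoop f p) := by
  have hs : ∀ {o o' : K} (b : PosetSimplex o o'),
      (d.holonomyBundle f).alongSimplex b = d.V (toLoop f (single b)) := by
    intro o o' b
    refine LinearIsometryEquiv.ext fun x => (d.V (toLoop f (ofLE b.le₀))).injective ?_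
    refine ((d.V (toLoop f (ofLE b.le₀))).apply_symm_apply _).trans ?_
    change d.V (toLoop f (ofLE b.le₁)) x =
      (d.V (toLoop f (ofLE b.le₀)) * d.V (toLoop f (single b))) x
    rw [← map_mul, toLoop_single]
  induction p with
  | single b => exact hs b
  | cons b p ih =>
    refine LinearIsometryEquiv.ext fun x => (DFunLike.congr_fun (hs b) _).trans ?_
    refine (congrArg (d.V (toLoop f (single b))) (DFunLike.congr_fun ih x)).trans ?_
    change (d.V (toLoop f (single b)) * d.V (toLoop f p)) x = d.V (toLoop f ((single b).comp p)) x
    rw [toLoop_comp, map_mul]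

theorem holonomy_toLoop (f : ∀ o, PosetPath a o) {o o' : K} (p : PosetPath o o')
    (x : 𝒜.envelope.fiber o) :
    𝒜.envelope.holonomy a (toLoop f p) (𝒜.envelope.along (f o).opp x) =
      𝒜.envelope.along (f o').opp (𝒜.envelope.along p x) := by
  change 𝒜.envelope.along ((f o').opp.comp (p.comp (f o))) _ = _
  rw [CStarNetBundle.along_comp, CStarNetBundle.along_comp]
  change 𝒜.envelope.along (f o').opp (𝒜.envelope.along p (𝒜.envelope.along (f o) _)) = _
  rw [CStarNetBundle.along_along_opp]

/-- The graded representation of the net with fibres `H` and holonomy `V`, given by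
`π_o(t) = η(ȷ̄_p ε_o(t))` for the chosen path `p : o → a`. -/
def IsCycle.gradedRepresentation
    (hd : d.IsCycle (𝒜.envelope.holonomy a) (β.envelopeAut a) i) (f : ∀ o, PosetPath a o) :
    GradedRepresentation 𝒜 β where
  bundle := d.holonomyBundle f
  Γ _ := d.Γ
  Γ_sq _ := hd.grading_sq
  Γ_comm h x := (hd.grading_comm _ x).symm
  rep :=
    { hom := fun o => d.η.comp
        ((𝒜.envelope.along (f o).opp : 𝒜.envelope.fiber o →⋆ₙₐ[ℂ] 𝒜.envelope.fiber a).comp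
          (𝒜.canonicalMor.hom o))
      comm := fun {o o'} h t => by
        refine (hd.covariant (toLoop f (ofLE h)) _).symm.trans (congrArg d.η ?_)
        refine (holonomy_toLoop f (ofLE h) _).trans (congrArg (𝒜.envelope.along (f o').opp) ?_)
        exact (CStarNetBundle.along_ofLE _ h _).trans (𝒜.canonicalMor.comm h t) }
  graded o t := by
    refine Eq.trans (congrArg d.η ?_)
      (hd.graded (𝒜.envelope.along (f o).opp (𝒜.canonicalMor.hom o t)))
    exact (GradedRepresentation.envelopeAut_generator (β := β) (f o).opp t).symm

variable (hd : d.IsCycle (𝒜.envelope.holonomy a) (β.envelopeAut a) i) (f : ∀ o, PosetPath a o)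

theorem IsCycle.conj_along_op (hf : f a = triv a) {o : K} (p : PosetPath o a) (t : 𝒜.fiber o) :
    ((hd.gradedRepresentation f).bundle.along p).conjStarAlgEquiv
      ((hd.gradedRepresentation f).op o t) =
      d.η (𝒜.envelope.along p (𝒜.canonicalMor.hom o t)) := by
  have h₁ : (hd.gradedRepresentation f).bundle.along p = d.V (toLoop f p) :=
    holonomyBundle_along f p
  rw [h₁]
  refine (hd.covariant (toLoop f p) _).symm.trans (congrArg d.η ?_)
  refine (holonomy_toLoop f p _).trans ?_
  rw [hf]
  exact CStarNetBundle.along_triv _ _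

theorem IsCycle.lift_gradedRepresentation (hf : f a = triv a) :
    (hd.gradedRepresentation f).lift a = d.η :=
  𝒜.envelope_hom_ext fun _ p t =>
    ((hd.gradedRepresentation f).lift_generator p t).trans (hd.conj_along_op f hf p t)

theorem IsCycle.holonomy_gradedRepresentation (hf : f a = triv a) :
    (hd.gradedRepresentation f).bundle.holonomy a = d.V := by
  refine MonoidHom.ext fun g => ?_
  obtain ⟨q⟩ := g
  exact (holonomyBundle_along f q).trans (congrArg d.V (toLoop_loop f hf q))

theorem IsCycle.unitarilyEquiv_gradedRepresentation (hf : f a = triv a) :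
    ((hd.gradedRepresentation f).datum a d.φ).UnitarilyEquiv d := by
  refine ⟨LinearIsometryEquiv.refl ℂ d.H, fun t x => ?_, fun g x => ?_, fun x => rfl, fun x => rfl⟩
  · exact DFunLike.congr_fun (DFunLike.congr_fun (hd.lift_gradedRepresentation f hf) t) x
  · exact DFunLike.congr_fun (DFunLike.congr_fun (hd.holonomy_gradedRepresentation f hf) g) x

/-- The localized Fredholm module of a cycle. -/
def IsCycle.localizedFredholmModule (hf : f a = triv a) (hstar : star d.φ = d.φ)
    (hsq : IsCompactOp (d.φ * d.φ - 1))
    (hV : ∀ g, IsCompactOp ((d.V g).conjStarAlgEquiv d.φ - d.φ)) :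
    LocalizedFredholmModule 𝒜 β i a where
  toGradedRepresentation := hd.gradedRepresentation f
  F := d.φ
  even := hd.even
  odd hi _ := hd.odd hi
  selfAdjoint := hstar
  compact_sq := hsq
  compact_comm o p t := by
    rw [hd.conj_along_op f hf, hd.conj_along_op f hf, ← GradedRepresentation.envelopeAut_generator]
    exact hd.compact_comm _
  compact_equivariant q := by
    have h : (hd.gradedRepresentation f).bundle.along q = d.V (toLoop f q) :=
      holonomyBundle_along f q
    rw [h]
    exact hV _

/-- The Fredholm module of an invariant cycle: the operator is constant. -/
def IsCycle.fredholmModule (hinv : d.IsInvariant) (hstar : star d.φ = d.φ)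
    (hsq : IsCompactOp (d.φ * d.φ - 1)) : FredholmModule 𝒜 β i where
  toGradedRepresentation := hd.gradedRepresentation f
  F _ := d.φ
  even hi _ := hd.even hi
  odd hi _ := hd.odd hi
  selfAdjoint _ := hstar
  parallel {_ _} h := fun x : d.H => by
    have hx : d.V (toLoop f (ofLE h)) (d.φ ((d.V (toLoop f (ofLE h))).symm
        (d.V (toLoop f (ofLE h)) x))) = d.φ (d.V (toLoop f (ofLE h)) x) :=
      DFunLike.congr_fun (hinv (toLoop f (ofLE h))) _
    rwa [LinearIsometryEquiv.symm_apply_apply] at hx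
  compact_sq _ := hsq
  compact_comm o t := by
    have h := hd.compact_comm (𝒜.envelope.along (f o).opp (𝒜.canonicalMor.hom o t))
    rw [GradedRepresentation.envelopeAut_generator] at h
    exact h

end KasparovDatum

/-! ### Unitary equivalence of graded representations -/

namespace GradedRepresentation

variable {K : Type u} [PartialOrder K] {𝒜 : CStarNet.{u, u} K} {β : 𝒜.Grading} {a : K}
  {R R' : GradedRepresentation 𝒜 β}

theorem Equivalence.W_along (E : Equivalence R R') {o o' : K} (p : PosetPath o o')
    (x : R.bundle.fiber o) : E.W o' (R.bundle.along p x) = R'.bundle.along p (E.W o x) :=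
  HilbertNetBundle.map_along (fun o => E.W o) (fun h x => E.W_U h x) p x

/-- An equivalence of graded representations of the net induces an equivalence of the holonomy
representations on the fibres over `a`. -/
theorem Equivalence.unitarilyEquiv_datum (E : Equivalence R R')
    {F : R.bundle.fiber a →L[ℂ] R.bundle.fiber a} {F' : R'.bundle.fiber a →L[ℂ] R'.bundle.fiber a}
    (hF : ∀ x, E.W a (F x) = F' (E.W a x)) :
    (R.datum a F).UnitarilyEquiv (R'.datum a F') := by
  have h : (unitaryConjHom (E.W a)).comp (R.lift a) = R'.lift a :=
    𝒜.envelope_hom_ext fun o p t => by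
      change (E.W a).conjStarAlgEquiv (R.lift a _) = _
      rw [R.lift_generator, R'.lift_generator]
      ext x
      have hx : E.W o ((R.bundle.along p).symm ((E.W a).symm x)) =
          (R'.bundle.along p).symm x := by
        apply (R'.bundle.along p).injective
        rw [← E.W_along]
        simp only [LinearIsometryEquiv.apply_symm_apply]
      change E.W a (R.bundle.along p (R.op o t ((R.bundle.along p).symm ((E.W a).symm x)))) =
        R'.bundle.along p (R'.op o t ((R'.bundle.along p).symm x))
      rw [E.W_along, E.W_op, hx]
  refine ⟨E.W a, fun t (x : R.bundle.fiber a) => ?_, fun g x => ?_, E.W_Γ a, hF⟩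
  · have ht := DFunLike.congr_fun (DFunLike.congr_fun h t) (E.W a x)
    refine Eq.trans ?_ ht
    change E.W a (R.lift a t x) = E.W a (R.lift a t ((E.W a).symm (E.W a x)))
    rw [LinearIsometryEquiv.symm_apply_apply]
  · obtain ⟨q⟩ := g
    exact E.W_along q x

/-- Conversely, a unitary which intertwines the holonomy representations extends to an equivalence
of the representations of the net, by parallel transport along a choice of paths. -/
theorem exists_equivalence (f : ∀ o, PosetPath a o)
    (W : R.bundle.fiber a ≃ₗᵢ[ℂ] R'.bundle.fiber a)
    (hη : ∀ t x, W (R.lift a t x) = R'.lift a t (W x))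
    (hV : ∀ (q : PosetPath a a) x, W (R.bundle.along q x) = R'.bundle.along q (W x))
    (hΓ : ∀ x, W (R.Γ a x) = R'.Γ a (W x)) :
    ∃ E : Equivalence R R', ∀ o,
      E.W o = ((R.bundle.along (f o)).symm.trans W).trans (R'.bundle.along (f o)) := by
  refine ⟨{
    W := fun o => ((R.bundle.along (f o)).symm.trans W).trans (R'.bundle.along (f o))
    W_U := fun {o o'} h x => ?_
    W_Γ := fun o x => ?_
    W_op := fun o t x => ?_ }, fun o => rfl⟩
  · obtain ⟨y, rfl⟩ := (R.bundle.along (f o)).surjective x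
    change R'.bundle.along (f o') (W ((R.bundle.along (f o')).symm
        (R.bundle.U h (R.bundle.along (f o) y)))) =
      R'.bundle.U h (R'.bundle.along (f o) (W ((R.bundle.along (f o)).symm
        (R.bundle.along (f o) y))))
    have hq := hV ((f o').opp.comp ((PosetPath.ofLE h).comp (f o))) y
    simp only [HilbertNetBundle.along_comp, HilbertNetBundle.along_opp,
      LinearIsometryEquiv.trans_apply, HilbertNetBundle.along_ofLE] at hq
    rw [hq, LinearIsometryEquiv.apply_symm_apply, LinearIsometryEquiv.symm_apply_apply]
  · obtain ⟨y, rfl⟩ := (R.bundle.along (f o)).surjective x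
    change R'.bundle.along (f o) (W ((R.bundle.along (f o)).symm
        (R.Γ o (R.bundle.along (f o) y)))) =
      R'.Γ o (R'.bundle.along (f o) (W ((R.bundle.along (f o)).symm (R.bundle.along (f o) y))))
    rw [R.Γ_along, R'.Γ_along, LinearIsometryEquiv.symm_apply_apply,
      LinearIsometryEquiv.symm_apply_apply, hΓ]
  · have ht := hη (𝒜.envelope.along (f o).opp (𝒜.canonicalMor.hom o t))
      ((R.bundle.along (f o)).symm x)
    rw [R.lift_generator, R'.lift_generator, HilbertNetBundle.along_opp,
      HilbertNetBundle.along_opp] at ht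
    simp only [LinearIsometryEquiv.conjStarAlgEquiv_apply_apply, LinearIsometryEquiv.symm_symm,
      LinearIsometryEquiv.apply_symm_apply] at ht
    change R'.bundle.along (f o) (W ((R.bundle.along (f o)).symm (R.op o t x))) =
      R'.op o t (R'.bundle.along (f o) (W ((R.bundle.along (f o)).symm x)))
    rw [ht, LinearIsometryEquiv.apply_symm_apply]

end GradedRepresentation

section Fredholm

variable {K : Type u} [PartialOrder K] {𝒜 : CStarNet.{u, u} K} {β : 𝒜.Grading} {i : Fin 2} {a : K}

theorem LocalizedFredholmModule.unitarilyEquiv_iff (hK : PathwiseConnected K)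
    (M M' : LocalizedFredholmModule 𝒜 β i a) :
    M.UnitarilyEquiv M' ↔ M.datum.UnitarilyEquiv M'.datum := by
  constructor
  · rintro ⟨E, hE⟩
    exact E.unitarilyEquiv_datum hE
  · rintro ⟨(W : M.bundle.fiber a ≃ₗᵢ[ℂ] M'.bundle.fiber a), hη, hV, hΓ, hφ⟩
    obtain ⟨f, hf⟩ := hK.exists_frame a
    obtain ⟨E, hE⟩ := GradedRepresentation.exists_equivalence f W hη
      (fun q => hV (PosetPi1.mk q)) hΓ
    have hEa : ∀ x, E.W a x = W x := fun x => by
      have h := HilbertNetBundle.along_triv M.bundle ((M.bundle.along (PosetPath.triv a)).symm x)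
      rw [LinearIsometryEquiv.apply_symm_apply] at h
      rw [hE, hf, LinearIsometryEquiv.trans_apply, LinearIsometryEquiv.trans_apply,
        HilbertNetBundle.along_triv, ← h]
    refine ⟨E, fun x => ?_⟩
    rw [hEa, hEa]
    exact hφ x

theorem FredholmModule.unitarilyEquiv_iff (hK : PathwiseConnected K) (M M' : FredholmModule 𝒜 β i) :
    M.UnitarilyEquiv M' ↔ (M.datum a).UnitarilyEquiv (M'.datum a) := by
  constructor
  · rintro ⟨E, hE⟩
    exact E.unitarilyEquiv_datum (hE a)
  · rintro ⟨(W : M.bundle.fiber a ≃ₗᵢ[ℂ] M'.bundle.fiber a), hη, hV, hΓ, hφ⟩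
    obtain ⟨f, -⟩ := hK.exists_frame a
    obtain ⟨E, hE⟩ := GradedRepresentation.exists_equivalence f W hη
      (fun q => hV (PosetPi1.mk q)) hΓ
    refine ⟨E, fun o x => ?_⟩
    obtain ⟨y, rfl⟩ := (M.bundle.along (f o)).surjective x
    rw [hE, M.F_along]
    change M'.bundle.along (f o) (W ((M.bundle.along (f o)).symm
        (M.bundle.along (f o) (M.F a y)))) =
      M'.F o (M'.bundle.along (f o) (W ((M.bundle.along (f o)).symm (M.bundle.along (f o) y))))
    rw [M'.F_along, LinearIsometryEquiv.symm_apply_apply, LinearIsometryEquiv.symm_apply_apply]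
    exact congrArg _ (hφ y)

end Fredholm

end

theorem theorem3p4 {K : Type u} [PartialOrder K] (hK : PathwiseConnected K)
    (𝒜 : CStarNet.{u, u} K) (β : 𝒜.Grading) (i : Fin 2) (hβ : i = 1 → β.IsTrivial) (a : K) :
    -- localized Fredholm modules define cycles
    (∀ M : LocalizedFredholmModule 𝒜 β i a,
      M.datum.IsCycle (𝒜.envelope.holonomy a) (β.envelopeAut a) i) ∧
    -- every element of the equivariant K-homology arises from a localized Fredholm module
    (∀ c : EquivariantKHomology.{u, u + 1, u} (𝒜.envelope.holonomy a) (β.envelopeAut a) i,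
      ∃ (M : LocalizedFredholmModule 𝒜 β i a)
        (hM : M.datum.IsCycle (𝒜.envelope.holonomy a) (β.envelopeAut a) i),
        EquivariantKHomology.mk _ _ _ M.datum hM = c) ∧
    -- the cycles which are themselves given by localized Fredholm modules
    (∀ d : KasparovDatum.{u, u + 1, u} (𝒜.envelope.fiber a) (PosetPi1 a),
      d.IsCycle (𝒜.envelope.holonomy a) (β.envelopeAut a) i →
      ((∃ M : LocalizedFredholmModule 𝒜 β i a, M.datum.UnitarilyEquiv d) ↔
        star d.φ = d.φ ∧ IsCompactOp (d.φ * d.φ - 1) ∧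
          ∀ g, IsCompactOp ((d.V g).conjStarAlgEquiv d.φ - d.φ))) ∧
    (∀ M M' : LocalizedFredholmModule 𝒜 β i a,
      M.UnitarilyEquiv M' ↔ M.datum.UnitarilyEquiv M'.datum) ∧
    -- Fredholm modules define invariant cycles
    (∀ M : FredholmModule 𝒜 β i,
      (M.datum a).IsCycle (𝒜.envelope.holonomy a) (β.envelopeAut a) i ∧
        (M.datum a).IsInvariant) ∧
    -- every element of the strongly equivariant K-homology arises from a Fredholm module
    (∀ c : StrongKHomology.{u, u + 1, u} (𝒜.envelope.holonomy a) (β.envelopeAut a) i,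
      ∃ (M : FredholmModule 𝒜 β i)
        (hM : (M.datum a).IsCycle (𝒜.envelope.holonomy a) (β.envelopeAut a) i)
        (hM' : (M.datum a).IsInvariant),
        StrongKHomology.mk _ _ _ (M.datum a) hM hM' = c) ∧
    -- the invariant cycles which are themselves given by Fredholm modules
    (∀ d : KasparovDatum.{u, u + 1, u} (𝒜.envelope.fiber a) (PosetPi1 a),
      d.IsCycle (𝒜.envelope.holonomy a) (β.envelopeAut a) i → d.IsInvariant →
      ((∃ M : FredholmModule 𝒜 β i, (M.datum a).UnitarilyEquiv d) ↔
        star d.φ = d.φ ∧ IsCompactOp (d.φ * d.φ - 1))) ∧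
    (∀ M M' : FredholmModule 𝒜 β i,
      M.UnitarilyEquiv M' ↔ (M.datum a).UnitarilyEquiv (M'.datum a)) := by
  obtain ⟨f, hf⟩ := hK.exists_frame a
  have he := 𝒜.isUnitElement_canonicalMor_one a
  refine ⟨fun M => M.isCycle_datum, fun c => ?_, fun d hd => ⟨?_, ?_⟩,
    LocalizedFredholmModule.unitarilyEquiv_iff hK,
    fun M => ⟨M.isCycle_datum a, M.isInvariant_datum a⟩, fun c => ?_,
    fun d hd hinv => ⟨?_, ?_⟩, FredholmModule.unitarilyEquiv_iff hK⟩
  · obtain ⟨d, hd⟩ := c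
    let M := (hd.isCycle_compression he).localizedFredholmModule f hf (hd.star_compression_φ he)
      (hd.compact_compression_sq he) (hd.compact_compression_equivariant he)
    refine ⟨M, M.isCycle_datum, (Quot.sound ?_).symm⟩
    exact ⟨hd.compressionFamily he, hd.isCycle_compressionFamily he,
      hd.compressionFamily_evaluatesTo_zero he,
      (hd.compressionFamily_evaluatesTo_one he).of_unitarilyEquiv
        ((hd.isCycle_compression he).unitarilyEquiv_gradedRepresentation f hf).symm⟩
  · rintro ⟨M, hM⟩
    refine ⟨hM.star_φ M.selfAdjoint, hM.compact_sq M.compact_sq, fun g => ?_⟩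
    obtain ⟨q⟩ := g
    exact hM.compact_equivariant (g := PosetPi1.mk q) (M.compact_equivariant q)
  · rintro ⟨hstar, hsq, hV⟩
    exact ⟨hd.localizedFredholmModule f hf hstar hsq hV,
      hd.unitarilyEquiv_gradedRepresentation f hf⟩
  · obtain ⟨d, hd, hinv⟩ := c
    let M := (hd.isCycle_compression he).fredholmModule f (hd.isInvariant_compression he hinv)
      (hd.star_compression_φ he) (hd.compact_compression_sq he)
    refine ⟨M, M.isCycle_datum a, M.isInvariant_datum a, (Quot.sound ?_).symm⟩
    exact ⟨hd.compressionFamily he, hd.isCycle_compressionFamily he,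
      hd.isInvariant_compressionFamily he hinv, hd.compressionFamily_evaluatesTo_zero he,
      (hd.compressionFamily_evaluatesTo_one he).of_unitarilyEquiv
        ((hd.isCycle_compression he).unitarilyEquiv_gradedRepresentation f hf).symm⟩
  · rintro ⟨M, hM⟩
    exact ⟨hM.star_φ (M.selfAdjoint a), hM.compact_sq (M.compact_sq a)⟩
  · rintro ⟨hstar, hsq⟩
    exact ⟨hd.fredholmModule f hinv hstar hsq, hd.unitarilyEquiv_gradedRepresentation f hf⟩
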